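/- A continuum is a nonempty compact connected metrizable space; an arc is a homeomorphic copy of $[0,1]$; a tree is a (nonempty) uniquely arcwise connected union of finitely many arcs; a continuum is tree-like if it is homeomorphic to an inverse limit of a sequence of trees with continuous bonding maps. A nondegenerate continuum is decomposable if it is the union of two proper subcontinua, and a continuum is hereditarily decomposable if each of its nondegenerate subcontinua is decomposable. A Cantor set in $[0,1]$ is a nonempty closed perfect nowhere dense set $C$; a point $x\in C$ is an endpoint of $C$ if $(a,x)\subseteq[0,1]\setminus C$ for some $a<x$ or $(x,a)\subseteq[0,1]\setminus C$ for some $a>x$. For $F:[0,1]\to 2^{[0,1]}$, $\varprojlim\{[0,1],F\}=\{x\in[0,1]^{\{0,1,2,\dots\}}: x_{n-1}\in F(x_n)\text{ for all }n\ge 1\}$, and similarly for a sequence of bonding functions. Let $\{C_r : r\in\mathbb{Q}\cap[0,1]\}$ be Cantor sets in $(0,1]$ such that, whenever $r>s$, $C_r\subsetneq C_s$ and no point of $C_r$ is an endpoint of $C_s$. Let $f:[0,1]\to[0,1]$ be continuous with $f(t)=0$ for $t\in\{0\}\cup C_0$, $f(t)<\min C_0$ for all $t\in[0,1]$, and $f(t)<t$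 for all $t\in(0,1]$. Put $$F(t)=\begin{cases}\{f(t)\}, & t\notin C_0,\\ [0,\sup\{r: t\in C_r\}], & t\in C_0,\end{cases}\qquad X=\varprojlim\{[0,1],F\}.$$ For $x\in X$ let $L_x=\varprojlim\{[0,1],G_{x,n}\}$, where the graph of $G_{x,n}$ $(n\ge1)$ is the graph of $f$ together with the (possibly degenerate) vertical segment from $(x_n,f(x_n))$ to $(x_n,x_{n-1})$. Let $\overline 0=(0,0,\dots)$ and let $\pi_n$ be the projection to the $n$-th coordinate. **Theorem.** $X$ is a hereditarily decomposable tree-like continuum. Moreover, for each $x\in X\setminus\{\overline 0\}$ the set $L_x$ is an arc with endpoints $x$ and $\overline 0$, and for every subcontinuum $K$ of $X$: 1. if $\overline 0\in K$, then $K=\bigcup_{x\in K}L_x$; 2. if $\overline 0\notin K$, then $\pi_n[K]$ is a single point for all but finitely many $n$, and if moreover $K$ is nondegenerate, then $K$ has a separating point, that is, a point $x\in K$ such that $K\setminus\{x\}$ is not connected. -/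

import Mathlib

open Set Filter Topology

/-- The set `K` is a continuum: a nonempty, compact, connected subset of a metrizable space. -/
def IsContinuum {Y : Type*} [TopologicalSpace Y] [TopologicalSpace.MetrizableSpace Y]
    (K : Set Y) : Prop :=
  IsCompact K ∧ IsConnected K

/-- `K` is the union of two proper subcontinua. -/
def IsDecomposable {Y : Type*} [TopologicalSpace Y] [TopologicalSpace.MetrizableSpace Y]
    (K : Set Y) : Prop :=
  ∃ A B : Set Y, IsContinuum A ∧ IsContinuum B ∧ A ⊂ K ∧ B ⊂ K ∧ A ∪ B = K

/-- Every nondegenerate subcontinuum of `X` is decomposable. -/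
def IsHereditarilyDecomposable {Y : Type*} [TopologicalSpace Y]
    [TopologicalSpace.MetrizableSpace Y] (X : Set Y) : Prop :=
  ∀ K : Set Y, K ⊆ X → IsContinuum K → K.Nontrivial → IsDecomposable K

/-- The point `x` separates `K`: it lies in `K`, and `K \ {x}` is not connected. -/
def IsSeparatingPoint {Y : Type*} [TopologicalSpace Y] (K : Set Y) (x : Y) : Prop :=
  x ∈ K ∧ ¬ IsPreconnected (K \ {x})

/-- The set `A` is an arc (a homeomorphic copy of `[0,1]`) with endpoints `p` and `q`. -/
def IsArcBetween {Y : Type*} [TopologicalSpace Y] (A : Set Y) (p q : Y) : Prop :=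
  ∃ h : unitInterval → Y, IsEmbedding h ∧ range h = A ∧ h 0 = p ∧ h 1 = q

/-- The (metrizable) space `T` is a tree: it is nonempty, it is a union of finitely many arcs, and
any two distinct points of it are the endpoints of exactly one arc. -/
def IsTopologicalTree (T : Type*) [TopologicalSpace T] [TopologicalSpace.MetrizableSpace T] :
    Prop :=
  Nonempty T ∧
  (∃ 𝒜 : Set (Set T), 𝒜.Finite ∧ (∀ A ∈ 𝒜, ∃ p q : T, IsArcBetween A p q) ∧ ⋃₀ 𝒜 = univ) ∧
  ∀ p q : T, p ≠ q → ∃! A : Set T, IsArcBetween A p q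

/-- The inverse limit of a sequence of spaces `X₀, X₁, …` with set-valued bonding functions
`F n : X (n + 1) → 2 ^ (X n)`: the sequences `x` with `x n ∈ F n (x (n + 1))` for all `n`,
with the topology of a subspace of the product. -/
def setInverseLimit {X : ℕ → Type*} (F : ∀ n, X (n + 1) → Set (X n)) : Set (∀ n, X n) :=
  {x | ∀ n, x n ∈ F n (x (n + 1))}

/-- The set `K` is homeomorphic to an inverse limit of trees with continuous (single-valued)
bonding maps. -/
def IsTreeLike {Y : Type*} [TopologicalSpace Y] (K : Set Y) : Prop :=
  ∃ (T : ℕ → Type) (_ : ∀ n, TopologicalSpace (T n))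
    (_ : ∀ n, TopologicalSpace.MetrizableSpace (T n)) (g : ∀ n, T (n + 1) → T n),
    (∀ n, IsTopologicalTree (T n)) ∧ (∀ n, Continuous (g n)) ∧
    Nonempty (K ≃ₜ setInverseLimit (fun n (t : T (n + 1)) => ({g n t} : Set (T n))))

/-- A Cantor set in `[0,1]`: nonempty, closed, without isolated points, nowhere dense. -/
def IsCantorSubset (C : Set unitInterval) : Prop :=
  C.Nonempty ∧ Perfect C ∧ IsNowhereDense C

/-- `x ∈ C` is a left or a right endpoint of `C`: an open interval on one side of `x`, inside
`[0,1]` and with end `x`, misses `C`. -/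
def IsCantorEndpoint (C : Set unitInterval) (x : unitInterval) : Prop :=
  x ∈ C ∧ ((∃ a, a < x ∧ Ioo a x ⊆ Cᶜ) ∨ (∃ a, x < a ∧ Ioo x a ⊆ Cᶜ))

/-- A family of Cantor sets in `(0,1]`, indexed by the rationals of `[0,1]`, such that for `s < r`
the set `C r` is a proper subset of `C s` and contains no endpoint of `C s`. -/
def IsNestedCantorFamily (C : Icc (0 : ℚ) 1 → Set unitInterval) : Prop :=
  (∀ r, IsCantorSubset (C r)) ∧ (∀ r, ∀ t ∈ C r, 0 < t) ∧
  ∀ r s, s < r → C r ⊂ C s ∧ ∀ t ∈ C r, ¬ IsCantorEndpoint (C s) t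

/-- The continuous functions `f : [0,1] → [0,1]` that are used with the family `C`: `f` vanishes on
`{0} ∪ C 0`, all its values are below `min (C 0)`, and `f t < t` for `t > 0`. -/
def IsAdmissibleBase (C : Icc (0 : ℚ) 1 → Set unitInterval) (f : unitInterval → unitInterval) :
    Prop :=
  Continuous f ∧ (∀ t ∈ ({0} : Set unitInterval) ∪ C 0, f t = 0) ∧
  (∀ t, ∀ c ∈ C 0, f t < c) ∧ ∀ t, 0 < t → f t < t

open Classical in
/-- `F t = {f t}` if `t ∉ C 0`, and `F t = [0, sup {r : t ∈ C r}]` if `t ∈ C 0`. -/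
noncomputable def cantorBonding (C : Icc (0 : ℚ) 1 → Set unitInterval)
    (f : unitInterval → unitInterval) (t : unitInterval) : Set unitInterval :=
  if t ∈ C 0 then
    {y | (y : ℝ) ≤ sSup {ρ : ℝ | ∃ r : Icc (0 : ℚ) 1, t ∈ C r ∧ ρ = ((r : ℚ) : ℝ)}}
  else {f t}

/-- The inverse limit `X` of `[0,1]` with the single bonding function `F`. -/
noncomputable def cantorLimit (C : Icc (0 : ℚ) 1 → Set unitInterval)
    (f : unitInterval → unitInterval) : Set (ℕ → unitInterval) :=
  setInverseLimit (fun _ => cantorBonding C f)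

/-- The set-valued function whose graph is the graph of `f` together with the vertical segment from
`(a, f a)` to `(a, b)`. -/
def whiskerBonding (f : unitInterval → unitInterval) (a b t : unitInterval) : Set unitInterval :=
  {y | y = f t ∨ (t = a ∧ y ∈ uIcc (f a) b)}

/-- `L_x`: the inverse limit whose `n`-th bonding function has as its graph the graph of `f`
together with the vertical segment from `(xₙ, f xₙ)` to `(xₙ, xₙ₋₁)`. -/
def limitArc (f : unitInterval → unitInterval) (x : ℕ → unitInterval) : Set (ℕ → unitInterval) :=
  setInverseLimit (fun n => whiskerBonding f (x (n + 1)) (x n))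

/-! ### Arcs, cuts along a level set, and boundary bumping. -/

section General

variable {Y : Type*} [TopologicalSpace Y]

/-! The map `defect` sends `x` to the sequence `x n - f (x (n + 1))`. A nonzero term forces `x (n +
1)` into `C 0`. The values of `f` lie below `C 0`, so no coordinate in `C 0` is an `f`-image, and
all later coordinates lie in `C 0` too; there `f` vanishes and the defect equals the coordinate.
Hence `defect` maps `X` into `branchSet E`, where `E` is the copy of `C 0` in the reals. It is
injective (`injOn_defect`) because a backward orbit of `f` converges to a fixed point, which can
only be `0`. As `X` is compact, it is an embedding, and it carries `limitArc f x` onto `stem (defect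
f x)` (`defect_image_limitArc`). What remains concerns stems in a branch set for which `E` has dense
complement.

A stem is a chain on which the strictly monotone `height` is injective, hence an arc. A coordinate
value `t` outside `E` forces all earlier coordinates to vanish, while the later ones, confined to
`E` above a positive level, are constant on connected sets. With boundary bumping this gives
`stem_subset`: a continuum through `0` contains the stem of each of its points. For a continuum
missing `0`, the last nonconstant coordinate has a one-point level set that cuts it
(`exists_level`). Decomposability follows from such a cut or, at `0`, from a splitting into two
unions of stems (`isDecomposable_of_zero_mem`).

For tree-likeness, `squash` keeps finitely many coordinates and applies a monotone map taking
finitely many values on `E`. The images are finite unions of stems, hence trees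
(`isTopologicalTree_of_finite`), and these maps refine one another and separate points
(`isTreeLike_of_quotients`). -/

lemma isArcBetween_of_injOn {A : Set Y} {σ : Y → ℝ} (hA : IsCompact A) (hA' : IsPreconnected A)
    (hσ : ContinuousOn σ A) (hi : InjOn σ A) {p q : Y} (hp : p ∈ A) (hq : q ∈ A) (hpq : p ≠ q)
    (hle : ∀ z ∈ A, σ p ≤ σ z ∧ σ z ≤ σ q) : IsArcBetween A p q := by
  have hlt : σ p < σ q := lt_of_le_of_ne (hle q hq).1 fun h => hpq (hi hp hq h)
  have hsurj : ∀ s ∈ Icc (σ p) (σ q), ∃ z ∈ A, σ z = s := fun s hs =>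
    (hA'.image σ hσ).ordConnected.out (mem_image_of_mem _ hp) (mem_image_of_mem _ hq) hs
  have : CompactSpace A := isCompact_iff_compactSpace.1 hA
  let φ : A → Icc (σ p) (σ q) := fun z => ⟨σ z, hle z z.2⟩
  have hφ : Continuous φ := (continuousOn_iff_continuous_domRestrict.1 hσ).subtype_mk _
  have hb : Function.Bijective φ := by
    constructor
    · intro a b h
      exact Subtype.ext (hi a.2 b.2 (congrArg Subtype.val h))
    · rintro ⟨s, hs⟩
      obtain ⟨z, hz, rfl⟩ := hsurj s hs
      exact ⟨⟨z, hz⟩, rfl⟩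
  let e : A ≃ₜ Icc (σ p) (σ q) :=
    Continuous.homeoOfEquivCompactToT2 (f := Equiv.ofBijective φ hb) hφ
  let k : unitInterval ≃ₜ A := (iccHomeoI (σ p) (σ q) hlt).symm.trans e.symm
  refine ⟨fun s => (k s : Y), IsEmbedding.subtypeVal.comp k.isEmbedding, ?_, ?_, ?_⟩
  · rw [show (fun s => (k s : Y)) = Subtype.val ∘ k from rfl, range_comp, k.surjective.range_eq]
    simp
  · have : k 0 = ⟨p, hp⟩ := by
      change e.symm _ = _
      rw [Homeomorph.symm_apply_eq]
      apply Subtype.ext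
      change _ = σ p
      simp
    simp [this]
  · have : k 1 = ⟨q, hq⟩ := by
      change e.symm _ = _
      rw [Homeomorph.symm_apply_eq]
      apply Subtype.ext
      change _ = σ q
      simp
    simp [this]

lemma IsArcBetween.symm {A : Set Y} {p q : Y} (h : IsArcBetween A p q) : IsArcBetween A q p := by
  obtain ⟨k, hk, hr, h0, h1⟩ := h
  refine ⟨k ∘ unitInterval.symmHomeomorph, hk.comp unitInterval.symmHomeomorph.isEmbedding,
    ?_, ?_, ?_⟩
  · rw [range_comp, unitInterval.symmHomeomorph.surjective.range_eq, image_univ, hr]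
  · simpa using h1
  · simpa using h0

lemma IsArcBetween.isCompact {A : Set Y} {p q : Y} (h : IsArcBetween A p q) : IsCompact A := by
  obtain ⟨k, hk, rfl, -⟩ := h
  exact isCompact_range hk.continuous

lemma IsArcBetween.isPreconnected {A : Set Y} {p q : Y} (h : IsArcBetween A p q) :
    IsPreconnected A := by
  obtain ⟨k, hk, rfl, -⟩ := h
  exact isPreconnected_range hk.continuous

lemma IsArcBetween.left_mem {A : Set Y} {p q : Y} (h : IsArcBetween A p q) : p ∈ A := by
  obtain ⟨k, -, rfl, rfl, -⟩ := h
  exact mem_range_self _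

lemma IsArcBetween.right_mem {A : Set Y} {p q : Y} (h : IsArcBetween A p q) : q ∈ A :=
  h.symm.left_mem

/-- A connected subset of an arc that contains both endpoints is the whole arc. -/
lemma IsArcBetween.eq_of_subset {A B : Set Y} {p q : Y} (h : IsArcBetween B p q)
    (hA : IsPreconnected A) (hAB : A ⊆ B) (hp : p ∈ A) (hq : q ∈ A) : A = B := by
  obtain ⟨k, hk, rfl, rfl, rfl⟩ := h
  have h1 : k '' (k ⁻¹' A) = A := image_preimage_eq_of_subset hAB
  have h2 : IsPreconnected (k ⁻¹' A) := by
    rw [← hk.isInducing.isPreconnected_image, h1]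
    exact hA
  have h3 : k ⁻¹' A = univ := by
    refine eq_univ_of_forall fun s => ?_
    exact h2.ordConnected.out (x := 0) (y := 1) hp hq ⟨unitInterval.nonneg', unitInterval.le_one'⟩
  rw [← h1, h3, image_univ]

/-- If the level set `{g = t}` of a connected set is at most one point, then the part where
`t ≤ g` is connected. -/
lemma IsPreconnected.inter_le_of_level {K : Set Y} (hK : IsPreconnected K) {g : Y → ℝ}
    (hg : Continuous g) {t : ℝ} {y : Y} (hy : ∀ z ∈ K, g z = t → z = y) :
    IsPreconnected (K ∩ {z | t ≤ g z}) := by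
  rw [isPreconnected_closed_iff] at hK ⊢
  have key : ∀ P Q : Set Y, IsClosed P → IsClosed Q → K ∩ {z | t ≤ g z} ⊆ P ∪ Q →
      (K ∩ {z | t ≤ g z} ∩ P).Nonempty → (K ∩ {z | t ≤ g z} ∩ Q).Nonempty →
      ∃ z ∈ K, t ≤ g z ∧ z ∈ Q ∧ (z ∈ P ∨ z = y) := by
    rintro P Q hP hQ hs ⟨a, ⟨haK, -⟩, haP⟩ ⟨b, ⟨hbK, hbt⟩, hbQ⟩
    -- `P` absorbs the sublevel set, so a common point of the two closed sets lies in `P` or at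
    -- level `t`, where only `y` is available.
    obtain ⟨z, hzK, hz1, hz2⟩ := hK (P ∪ {z | g z ≤ t}) (Q ∩ {z | t ≤ g z})
      (hP.union (isClosed_le hg continuous_const)) (hQ.inter (isClosed_le continuous_const hg))
      (fun z hz => by
        rcases le_total (g z) t with h | h
        · exact Or.inl (Or.inr h)
        · rcases hs ⟨hz, h⟩ with h' | h'
          · exact Or.inl (Or.inl h')
          · exact Or.inr ⟨h', h⟩)
      ⟨a, haK, Or.inl haP⟩ ⟨b, hbK, hbQ, hbt⟩
    refine ⟨z, hzK, hz2.2, hz2.1, hz1.imp id fun h => hy z hzK (le_antisymm h hz2.2)⟩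
  intro P Q hP hQ hs hsP hsQ
  by_cases hyP : y ∈ P
  · obtain ⟨z, h1, h2, h3, h4⟩ := key P Q hP hQ hs hsP hsQ
    exact ⟨z, ⟨h1, h2⟩, h4.elim id (fun h => h ▸ hyP), h3⟩
  · obtain ⟨z, h1, h2, h3, h4⟩ := key Q P hQ hP (by rwa [union_comm]) hsQ hsP
    exact ⟨z, ⟨h1, h2⟩, h3, h4.elim id (fun h => absurd (h ▸ h3) hyP)⟩

lemma isSeparatingPoint_of_level {K : Set Y} {g : Y → ℝ} (hg : Continuous g) {t : ℝ} {a b y : Y}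
    (hyK : y ∈ K) (hy : ∀ z ∈ K, g z = t → z = y) (hgy : g y = t) (ha : a ∈ K) (hb : b ∈ K)
    (hat : g a < t) (htb : t < g b) : IsSeparatingPoint K y := by
  refine ⟨hyK, fun h => ?_⟩
  obtain ⟨z, -, hz1, hz2⟩ := h {z | g z < t} {z | t < g z} (isOpen_lt hg continuous_const)
    (isOpen_lt continuous_const hg)
    (fun z hz => lt_or_gt_of_ne fun h => hz.2 (hy z hz.1 h))
    ⟨a, ⟨ha, fun h => by simp only [mem_singleton_iff] at h; subst h; linarith⟩, hat⟩
    ⟨b, ⟨hb, fun h => by simp only [mem_singleton_iff] at h; subst h; linarith⟩, htb⟩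
  exact lt_asymm (show g z < t from hz1) hz2

lemma isDecomposable_of_level [TopologicalSpace.MetrizableSpace Y] {K : Set Y}
    (hK : IsContinuum K) {g : Y → ℝ} (hg : Continuous g) {t : ℝ} {a b y : Y}
    (hy : ∀ z ∈ K, g z = t → z = y) (ha : a ∈ K) (hb : b ∈ K)
    (hat : g a < t) (htb : t < g b) : IsDecomposable K := by
  refine ⟨K ∩ {z | g z ≤ t}, K ∩ {z | t ≤ g z},
    ⟨hK.1.inter_right (isClosed_le hg continuous_const), ⟨a, ha, hat.le⟩, ?_⟩,
    ⟨hK.1.inter_right (isClosed_le continuous_const hg), ⟨b, hb, htb.le⟩,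
      hK.2.isPreconnected.inter_le_of_level hg hy⟩, ?_, ?_, ?_⟩
  · have := hK.2.isPreconnected.inter_le_of_level hg.neg (t := -t) (y := y)
      fun z hz h => hy z hz (neg_injective h)
    simpa using this
  · exact ssubset_of_subset_of_ne inter_subset_left
      fun h => absurd (h.symm ▸ hb : b ∈ K ∩ {z | g z ≤ t}).2 (not_le.2 htb)
  · exact ssubset_of_subset_of_ne inter_subset_left
      fun h => absurd (h.symm ▸ ha : a ∈ K ∩ {z | t ≤ g z}).2 (not_le.2 hat)
  · rw [← inter_union_distrib_left]
    exact inter_eq_left.2 fun z _ => le_total (g z) t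

/-- Boundary bumping: in a continuum, the component of a point in a superlevel set of a continuous
function reaches the boundary level. -/
lemma exists_isPreconnected_superlevel [T2Space Y] {K : Set Y} (hK : IsCompact K)
    (hK' : IsPreconnected K) {g : Y → ℝ} (hg : Continuous g) {t : ℝ} {o x : Y} (ho : o ∈ K)
    (hx : x ∈ K) (hot : g o < t) (htx : t ≤ g x) :
    ∃ P ⊆ K ∩ {z | t ≤ g z}, IsPreconnected P ∧ x ∈ P ∧ ∃ z ∈ P, g z = t := by
  set S : Set Y := K ∩ {z | t ≤ g z} with hS
  have hSc : IsCompact S := hK.inter_right (isClosed_le continuous_const hg)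
  have : CompactSpace S := isCompact_iff_compactSpace.1 hSc
  let x' : S := ⟨x, hx, htx⟩
  refine ⟨Subtype.val '' connectedComponent x', by rintro _ ⟨z, -, rfl⟩; exact z.2,
    isPreconnected_connectedComponent.image _ continuous_subtype_val.continuousOn,
    ⟨x', mem_connectedComponent, rfl⟩, ?_⟩
  by_contra! hcon
  have hB : IsOpen {z : S | g z ≠ t} :=
    isOpen_ne_fun (hg.comp continuous_subtype_val) continuous_const
  -- In a compact Hausdorff space a component is the intersection of its clopen neighbourhoods, so
  -- one of them already avoids level `t`; it then splits off from all of `K`.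
  obtain ⟨V, hV⟩ : ∃ V : {s : Set S // IsClopen s ∧ x' ∈ s}, (V : Set S) ⊆ {z : S | g z ≠ t} := by
    have : Nonempty {s : Set S // IsClopen s ∧ x' ∈ s} := ⟨⟨univ, isClopen_univ, mem_univ _⟩⟩
    refine exists_subset_nhds_of_compactSpace (V := fun s : {s : Set S // IsClopen s ∧ x' ∈ s} => s.1)
      ?_ (fun s => s.2.1.1) ?_
    · intro a b
      exact ⟨⟨a.1 ∩ b.1, a.2.1.inter b.2.1, a.2.2, b.2.2⟩, inter_subset_left, inter_subset_right⟩
    · intro z hz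
      rw [← connectedComponent_eq_iInter_isClopen] at hz
      exact hB.mem_nhds (hcon z ⟨z, hz, rfl⟩)
  have hcl : ∀ W : Set S, IsClosed W → IsClosed (Subtype.val '' W) := fun W hW =>
    (hW.isCompact.image continuous_subtype_val).isClosed
  obtain ⟨z, hzK, ⟨v, hv, rfl⟩, hz⟩ := isPreconnected_closed_iff.1 hK' (Subtype.val '' V.1)
    (Subtype.val '' (V.1)ᶜ ∪ {z | g z ≤ t}) (hcl _ V.2.1.1)
    ((hcl _ V.2.1.compl.1).union (isClosed_le hg continuous_const))
    (fun z hz => by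
      rcases le_total (g z) t with h | h
      · exact Or.inr (Or.inr h)
      · by_cases h' : (⟨z, hz, h⟩ : S) ∈ V.1
        · exact Or.inl ⟨_, h', rfl⟩
        · exact Or.inr (Or.inl ⟨_, h', rfl⟩))
    ⟨x, hx, x', V.2.2, rfl⟩ ⟨o, ho, Or.inr hot.le⟩
  rcases hz with ⟨w, hw, hwv⟩ | hz
  · exact hw (Subtype.ext hwv ▸ hv)
  · exact hV hv (le_antisymm hz v.2.2)

end General

/-! ### Stems: order, closedness, connectedness. -/

/-- The points obtained from `x` by cutting it at some coordinate: the `n`-th coordinate is lowered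
and all earlier ones become zero. -/
def stem (x : ℕ → ℝ) : Set (ℕ → ℝ) :=
  {w | ∀ n, 0 ≤ w n ∧ w n ≤ x n ∧ (w n ≠ 0 → ∀ i, n < i → w i = x i)}

/-- The nonnegative sequences all of whose coordinates after a nonzero one lie in `E`. -/
def branchSet (E : Set ℝ) : Set (ℕ → ℝ) :=
  {x | ∀ n, 0 ≤ x n ∧ (x n ≠ 0 → ∀ i, n < i → x i ∈ E)}

/-- The sequence with zeros before `n`, the value `t` at `n`, and the coordinates of `x` after. -/
def cutAt (x : ℕ → ℝ) (n : ℕ) (t : ℝ) : ℕ → ℝ :=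
  fun i => if i < n then 0 else if i = n then t else x i

section Cut

variable {x w v : ℕ → ℝ} {n i : ℕ} {t : ℝ}

@[simp] lemma cutAt_self : cutAt x n t n = t := by simp [cutAt]

lemma cutAt_of_lt (h : i < n) : cutAt x n t i = 0 := by simp [cutAt, h]

lemma cutAt_of_gt (h : n < i) : cutAt x n t i = x i := by
  simp [cutAt, h.not_gt, h.ne']

lemma eq_cutAt (h1 : ∀ i < n, w i = 0) (h2 : w n = t) (h3 : ∀ i, n < i → w i = x i) :
    w = cutAt x n t := by
  ext i
  rcases lt_trichotomy i n with h | rfl | h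
  · rw [h1 i h, cutAt_of_lt h]
  · rw [h2, cutAt_self]
  · rw [h3 i h, cutAt_of_gt h]

lemma continuous_cutAt (x : ℕ → ℝ) (n : ℕ) : Continuous (cutAt x n) := by
  refine continuous_pi fun i => ?_
  rcases lt_trichotomy i n with h | rfl | h
  · simp only [cutAt_of_lt h]; exact continuous_const
  · simp only [cutAt_self]; exact continuous_id
  · simp only [cutAt_of_gt h]; exact continuous_const

lemma cutAt_mem_stem (hx : ∀ i, 0 ≤ x i) (h0 : 0 ≤ t) (ht : t ≤ x n) : cutAt x n t ∈ stem x := by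
  intro i
  rcases lt_trichotomy i n with h | rfl | h
  · simp [cutAt_of_lt h, hx i]
  · refine ⟨by simpa, by simpa, fun _ j hj => cutAt_of_gt hj⟩
  · rw [cutAt_of_gt h]
    exact ⟨hx i, le_rfl, fun _ j hj => cutAt_of_gt (h.trans hj)⟩

lemma exists_eq_zero_of_lt (hw : w ≠ 0) : ∃ n, w n ≠ 0 ∧ ∀ i < n, w i = 0 := by
  classical
  have h : ∃ n, w n ≠ 0 := Function.ne_iff.1 hw
  exact ⟨Nat.find h, Nat.find_spec h, fun i hi => not_not.1 (Nat.find_min h hi)⟩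

lemma exists_eq_cutAt (hw : w ∈ stem x) (h0 : w ≠ 0) :
    ∃ n, 0 < w n ∧ w n ≤ x n ∧ w = cutAt x n (w n) := by
  obtain ⟨n, hn, hlt⟩ := exists_eq_zero_of_lt h0
  exact ⟨n, lt_of_le_of_ne (hw n).1 hn.symm, (hw n).2.1, eq_cutAt hlt rfl ((hw n).2.2 hn)⟩

lemma zero_mem_stem (hx : ∀ i, 0 ≤ x i) : (0 : ℕ → ℝ) ∈ stem x :=
  fun n => ⟨le_rfl, hx n, fun h => absurd rfl h⟩

lemma self_mem_stem (hx : ∀ i, 0 ≤ x i) : x ∈ stem x :=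
  fun n => ⟨hx n, le_rfl, fun _ _ _ => rfl⟩

lemma stem_trans (hw : w ∈ stem v) (hv : v ∈ stem x) : w ∈ stem x := by
  intro n
  refine ⟨(hw n).1, (hw n).2.1.trans (hv n).2.1, fun h i hi => ?_⟩
  have h' : v n ≠ 0 := fun h0 => h (le_antisymm (h0 ▸ (hw n).2.1) (hw n).1)
  rw [(hw n).2.2 h i hi, (hv n).2.2 h' i hi]

/-- If `v i < w i` with `i < j`, then `w i ≠ 0` forces `w j = x j`, which bounds `v j`. -/
lemma stem_total (hw : w ∈ stem x) (hv : v ∈ stem x) : w ≤ v ∨ v ≤ w := by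
  by_contra! h
  simp only [Pi.le_def, not_forall, not_le] at h
  obtain ⟨⟨i, hi⟩, j, hj⟩ := h
  have h1 : w i ≠ 0 := ((hv i).1.trans_lt hi).ne'
  have h2 : v j ≠ 0 := ((hw j).1.trans_lt hj).ne'
  rcases lt_trichotomy i j with h | rfl | h
  · have := (hw i).2.2 h1 j h
    linarith [(hv j).2.1]
  · linarith
  · have := (hv j).2.2 h2 i h
    linarith [(hw i).2.1]

/-- Closedness is needed jointly in both variables, because unions of stems with varying tips must
be compact. -/
lemma isClosed_stem_rel : IsClosed {p : (ℕ → ℝ) × (ℕ → ℝ) | p.1 ∈ stem p.2} := by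
  have h1 : ∀ n : ℕ, Continuous fun p : (ℕ → ℝ) × (ℕ → ℝ) => p.1 n := fun n => by fun_prop
  have h2 : ∀ n : ℕ, Continuous fun p : (ℕ → ℝ) × (ℕ → ℝ) => p.2 n := fun n => by fun_prop
  have h : {p : (ℕ → ℝ) × (ℕ → ℝ) | p.1 ∈ stem p.2} = ⋂ n, {p | 0 ≤ p.1 n} ∩
      ({p | p.1 n ≤ p.2 n} ∩ ({p | p.1 n = 0} ∪ ⋂ i ∈ Ioi n, {p | p.1 i = p.2 i})) := by
    ext p
    have : ∀ n, (p.1 n ≠ 0 → ∀ i, n < i → p.1 i = p.2 i) ↔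
        (p.1 n = 0 ∨ ∀ i, n < i → p.1 i = p.2 i) := fun n => by tauto
    simp [stem, this]
  rw [h]
  exact isClosed_iInter fun n => (isClosed_le continuous_const (h1 n)).inter
    ((isClosed_le (h1 n) (h2 n)).inter ((isClosed_eq (h1 n) continuous_const).union
      (isClosed_biInter fun i _ => isClosed_eq (h1 i) (h2 i))))

lemma isCompact_stem (x : ℕ → ℝ) : IsCompact (stem x) := by
  refine (isCompact_univ_pi fun n => isCompact_Icc (a := (0 : ℝ)) (b := x n)).of_isClosed_subset
    (isClosed_stem_rel.preimage (continuous_id.prodMk continuous_const))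
    fun w hw n _ => ⟨(hw n).1, (hw n).2.1⟩

lemma isPreconnected_stem (hx : ∀ i, 0 ≤ x i) : IsPreconnected (stem x) := by
  let S : ℕ → Set (ℕ → ℝ) := fun n => cutAt x n '' Icc 0 (x n)
  have hS : IsPreconnected (⋃ n, S n) := by
    refine (IsPreconnected.iUnion_of_chain (fun n => isPreconnected_Icc.image _
      (continuous_cutAt x n).continuousOn) fun n => ?_)
    -- Consecutive segments share an end: lowering coordinate `n` to `0` is the same as cutting at
    -- `n + 1` at full height. Only `0` is missing from the union, and it is a limit of these ends.
    refine ⟨cutAt x n 0, ⟨0, ⟨le_rfl, hx n⟩, rfl⟩, x (n + 1), ⟨hx _, le_rfl⟩, ?_⟩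
    symm
    refine eq_cutAt (fun i hi => ?_) ?_ fun i hi => ?_
    · rcases (Nat.lt_succ_iff_lt_or_eq.1 hi) with h | rfl
      · exact cutAt_of_lt h
      · simp
    · exact cutAt_of_gt (Nat.lt_succ_self n)
    · exact cutAt_of_gt ((Nat.lt_succ_self n).trans hi)
  refine hS.subset_closure ?_ ?_
  · rintro w hw
    obtain ⟨n, t, ht, rfl⟩ := mem_iUnion.1 hw
    exact cutAt_mem_stem hx ht.1 ht.2
  · intro w hw
    by_cases h0 : w = 0
    · subst h0
      refine mem_closure_of_tendsto (f := fun n => cutAt x n 0) (b := atTop) ?_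
        (Eventually.of_forall fun n => mem_iUnion.2 ⟨n, 0, ⟨le_rfl, hx n⟩, rfl⟩)
      refine tendsto_pi_nhds.2 fun i => tendsto_const_nhds.congr' ?_
      filter_upwards [eventually_gt_atTop i] with n hn
      rw [cutAt_of_lt hn]; rfl
    · obtain ⟨n, h1, h2, h3⟩ := exists_eq_cutAt hw h0
      exact subset_closure (mem_iUnion.2 ⟨n, w n, ⟨h1.le, h2⟩, h3.symm⟩)

end Cut

/-! ### Stems are arcs. -/

/-- A continuous strictly monotone functional on sequences. -/
noncomputable def height (w : ℕ → ℝ) : ℝ := ∑' n, (1 / 2 : ℝ) ^ n * Real.arctan (w n)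

lemma abs_height_term_le (w : ℕ → ℝ) (n : ℕ) :
    ‖(1 / 2 : ℝ) ^ n * Real.arctan (w n)‖ ≤ (1 / 2 : ℝ) ^ n * 2 := by
  rw [norm_mul, Real.norm_eq_abs, abs_of_pos (by positivity), Real.norm_eq_abs]
  refine mul_le_mul_of_nonneg_left (abs_le.2 ?_) (by positivity)
  constructor <;> linarith [Real.neg_pi_div_two_lt_arctan (w n), Real.arctan_lt_pi_div_two (w n),
    Real.pi_lt_four]

lemma summable_height_bound : Summable fun n : ℕ => (1 / 2 : ℝ) ^ n * 2 :=
  summable_geometric_two.mul_right 2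

lemma continuous_height : Continuous height :=
  continuous_tsum (fun n => continuous_const.mul
    (Real.continuous_arctan.comp (continuous_apply n))) summable_height_bound
    fun n w => abs_height_term_le w n

lemma strictMono_height : StrictMono height := by
  intro w v h
  obtain ⟨hle, i, hi⟩ := Pi.lt_def.1 h
  exact Summable.tsum_lt_tsum (i := i)
    (fun n => mul_le_mul_of_nonneg_left (Real.arctan_strictMono.monotone (hle n)) (by positivity))
    (mul_lt_mul_of_pos_left (Real.arctan_strictMono hi) (by positivity))
    (Summable.of_norm_bounded summable_height_bound (abs_height_term_le w))
    (Summable.of_norm_bounded summable_height_bound (abs_height_term_le v))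

lemma injOn_height_stem (x : ℕ → ℝ) : InjOn height (stem x) := by
  intro w hw v hv h
  rcases stem_total hw hv with h' | h'
  · exact h'.eq_of_not_lt fun hlt => (strictMono_height hlt).ne h
  · exact (h'.eq_of_not_lt fun hlt => (strictMono_height hlt).ne' h).symm

lemma isArcBetween_stem {x : ℕ → ℝ} (hx : ∀ i, 0 ≤ x i) (h0 : x ≠ 0) :
    IsArcBetween (stem x) 0 x :=
  isArcBetween_of_injOn (isCompact_stem x) (isPreconnected_stem hx) continuous_height.continuousOn
    (injOn_height_stem x) (zero_mem_stem hx) (self_mem_stem hx) h0.symm fun _ hz =>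
    ⟨strictMono_height.monotone fun n => (hz n).1, strictMono_height.monotone fun n => (hz n).2.1⟩

/-! ### Subcontinua of a branch set. -/

section Branch

variable {E : Set ℝ} {K : Set (ℕ → ℝ)} {x : ℕ → ℝ}

lemma IsPreconnected.subsingleton_of_dense_compl {S : Set ℝ} (hS : IsPreconnected S)
    (hE : Dense Eᶜ) (hSE : S ⊆ E) : S.Subsingleton := by
  have key : ∀ a ∈ S, ∀ b ∈ S, ¬ a < b := fun a ha b hb hab => by
    obtain ⟨t, ht, h⟩ := hE.exists_between hab
    exact ht (hSE (hS.ordConnected.out ha hb ⟨h.1.le, h.2.le⟩))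
  exact fun a ha b hb => le_antisymm (not_lt.1 (key b hb a ha)) (not_lt.1 (key a ha b hb))

/-- A nonzero coordinate before `n` would put `t` into `E`. This is why all cuts are made at levels
outside `E`. -/
lemma eq_cutAt_of_mem_branchSet {z : ℕ → ℝ} {n : ℕ} {t : ℝ} (hz : z ∈ branchSet E)
    (htE : t ∉ E) (h : z n = t) (hx : ∀ i, n < i → z i = x i) : z = cutAt x n t :=
  eq_cutAt (fun i hi => by_contra fun h0 => htE (h ▸ (hz i).2 h0 n hi)) h hx

/-- A continuum in the branch set that contains `0` contains the stem of each of its points. -/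
lemma stem_subset (hE : Dense Eᶜ) (hKE : K ⊆ branchSet E) (hK : IsCompact K)
    (hK' : IsPreconnected K) (h0 : (0 : ℕ → ℝ) ∈ K) (hx : x ∈ K) : stem x ⊆ K := by
  have key : ∀ n, ∀ t ∈ Ioo 0 (x n) ∩ Eᶜ, cutAt x n t ∈ K := by
    -- On a connected piece of `{t ≤ z n}` through `x` the coordinates after `n` lie in `E`, hence
    -- are those of `x`; where the piece reaches level `t` it must be the cut point of `x`.
    rintro n t ⟨ht, htE⟩
    obtain ⟨P, hPK, hP, hxP, z, hzP, hz⟩ := exists_isPreconnected_superlevel hK hK'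
      (continuous_apply n) (t := t) h0 hx ht.1 ht.2.le
    rw [← eq_cutAt_of_mem_branchSet (x := x) (hKE (hPK hzP).1) htE hz]
    · exact (hPK hzP).1
    · intro i hi
      refine (hP.image (fun w : ℕ → ℝ => w i)
        (continuous_apply i).continuousOn).subsingleton_of_dense_compl hE ?_ ⟨z, hzP, rfl⟩
        ⟨x, hxP, rfl⟩
      rintro _ ⟨w, hw, rfl⟩
      have hwn : t ≤ w n := (hPK hw).2
      exact (hKE (hPK hw).1 n).2 (by linarith [ht.1] : (0 : ℝ) < w n).ne' i hi
  intro w hw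
  by_cases hw0 : w = 0
  · rwa [hw0]
  obtain ⟨n, h1, h2, h3⟩ := exists_eq_cutAt hw hw0
  have hcl : w n ∈ closure (Ioo 0 (x n) ∩ Eᶜ) := by
    have hsub := closure_minimal (hE.open_subset_closure_inter (isOpen_Ioo (a := 0) (b := x n))) isClosed_closure
    rw [closure_Ioo (h1.trans_le h2).ne] at hsub
    exact hsub ⟨h1.le, h2⟩
  rw [h3]
  exact hK.isClosed.closure_subset_iff.2 (image_subset_iff.2 (key n))
    (image_closure_subset_closure_image (continuous_cutAt x n) (mem_image_of_mem _ hcl))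

/-- Since `0 ∉ E`, a coordinate once nonzero stays nonzero. Compactness gives one index `N` at which
every point of `K` is nonzero, so the later coordinates live in `E`. -/
lemma exists_subsingleton_coord (hE : Dense Eᶜ) (h0E : (0 : ℝ) ∉ E) (hKE : K ⊆ branchSet E)
    (hK : IsCompact K) (hK' : IsPreconnected K) (h0 : (0 : ℕ → ℝ) ∉ K) :
    ∃ N, ∀ n, N < n → ((fun z : ℕ → ℝ => z n) '' K).Subsingleton := by
  have hmono : ∀ z ∈ K, ∀ n, z n ≠ 0 → ∀ i, n ≤ i → z i ≠ 0 := fun z hz n hn i hi => by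
    rcases hi.eq_or_lt with rfl | hi
    · exact hn
    · exact fun h => h0E (h ▸ (hKE hz n).2 hn i hi)
  obtain ⟨N, hN⟩ : ∃ N, ∀ z ∈ K, z N ≠ 0 := by
    obtain ⟨F, hF⟩ := hK.elim_finite_subcover (fun n : ℕ => {z : ℕ → ℝ | z n ≠ 0})
      (fun n => isOpen_ne_fun (continuous_apply n) continuous_const) fun z hz =>
        mem_iUnion.2 (Function.ne_iff.1 (show z ≠ 0 from fun h => h0 (h ▸ hz)))
    refine ⟨F.sup id, fun z hz => ?_⟩
    obtain ⟨n, hn, hzn⟩ := mem_iUnion₂.1 (hF hz)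
    exact hmono z hz n hzn _ (Finset.le_sup (f := id) hn)
  refine ⟨N, fun n hn => (hK'.image _ (continuous_apply n).continuousOn).subsingleton_of_dense_compl
    hE ?_⟩
  rintro _ ⟨z, hz, rfl⟩
  exact (hKE hz N).2 (hN z hz) n hn

/-- A nondegenerate continuum in the branch set that misses `0` has a level set of some coordinate
that consists of one point and cuts the continuum. -/
lemma exists_level (hE : Dense Eᶜ) (h0E : (0 : ℝ) ∉ E) (hKE : K ⊆ branchSet E)
    (hK : IsCompact K) (hK' : IsPreconnected K) (h0 : (0 : ℕ → ℝ) ∉ K) (hnt : K.Nontrivial) :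
    ∃ n t, ∃ a ∈ K, ∃ b ∈ K, ∃ y ∈ K, a n < t ∧ t < b n ∧ y n = t ∧ ∀ z ∈ K, z n = t → z = y := by
  classical
  obtain ⟨N, hN⟩ := exists_subsingleton_coord hE h0E hKE hK hK' h0
  let p : ℕ → Prop := fun M => ∀ n, M ≤ n → ((fun z : ℕ → ℝ => z n) '' K).Subsingleton
  have hp : ∃ M, p M := ⟨N + 1, fun n hn => hN n hn⟩
  have hM := Nat.find_spec hp
  have hmin : ∀ M < Nat.find hp, ¬ p M := fun M => Nat.find_min hp
  rcases Nat.eq_zero_or_pos (Nat.find hp) with h | h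
  · obtain ⟨a, ha, b, hb, hab⟩ := hnt
    exact absurd (funext fun n => hM n (by omega) ⟨a, ha, rfl⟩ ⟨b, hb, rfl⟩) hab
  -- This `n` is the last coordinate that is not constant on `K`.
  obtain ⟨n, hn⟩ : ∃ n, Nat.find hp = n + 1 := ⟨_, (Nat.succ_pred_eq_of_pos h).symm⟩
  rw [hn] at hM hmin
  have hns : ¬ ((fun z : ℕ → ℝ => z n) '' K).Subsingleton := fun hs =>
    hmin n (Nat.lt_succ_self n) fun i hi => by
      rcases hi.eq_or_lt with rfl | hi
      · exact hs
      · exact hM i hi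
  obtain ⟨_, ⟨a, ha, rfl⟩, _, ⟨b, hb, rfl⟩, hab⟩ := (not_subsingleton_iff.1 hns).exists_lt
  obtain ⟨t, htE, ht⟩ := hE.exists_between hab
  have hpc := hK'.image _ (continuous_apply n).continuousOn
  obtain ⟨y, hy, hyt⟩ := hpc.ordConnected.out ⟨a, ha, rfl⟩ ⟨b, hb, rfl⟩ ⟨ht.1.le, ht.2.le⟩
  refine ⟨n, t, a, ha, b, hb, y, hy, ht.1, ht.2, hyt, fun z hz hzt => ?_⟩
  have hy' := eq_cutAt_of_mem_branchSet (x := y) (hKE hy) htE hyt fun _ _ => rfl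
  rw [hy']
  exact eq_cutAt_of_mem_branchSet (hKE hz) htE hzt fun i hi =>
    hM i hi ⟨z, hz, rfl⟩ ⟨y, hy, rfl⟩

/-- The total deviation of `z` from `x` in the coordinates after `n`. -/
noncomputable def tailDeviation (x : ℕ → ℝ) (n : ℕ) (z : ℕ → ℝ) : ℝ :=
  height fun i => |z (n + 1 + i) - x (n + 1 + i)|

lemma height_zero : height 0 = 0 := by simp [height]

lemma continuous_tailDeviation (x : ℕ → ℝ) (n : ℕ) : Continuous (tailDeviation x n) :=
  continuous_height.comp (by fun_prop)

lemma tailDeviation_congr {n : ℕ} {z w : ℕ → ℝ} (h : ∀ i, n < i → z i = w i) :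
    tailDeviation x n z = tailDeviation x n w := by
  simp only [tailDeviation]
  congr 1
  ext i
  rw [h _ (by omega)]

lemma tailDeviation_pos {n : ℕ} {z : ℕ → ℝ} (h : ¬ ∀ i, n < i → z i = x i) :
    0 < tailDeviation x n z := by
  rw [← height_zero]
  refine strictMono_height (Pi.lt_def.2 ⟨fun i => abs_nonneg _, ?_⟩)
  push Not at h
  obtain ⟨i, hi, hne⟩ := h
  refine ⟨i - (n + 1), ?_⟩
  rw [show n + 1 + (i - (n + 1)) = i by omega]
  exact abs_pos.2 (sub_ne_zero.2 hne)

lemma tailDeviation_self (n : ℕ) : tailDeviation x n x = 0 := by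
  simp only [tailDeviation, sub_self, abs_zero]
  exact height_zero

lemma isContinuum_of_stem_subset {A : Set (ℕ → ℝ)} (hA : IsCompact A)
    (hpos : ∀ z ∈ A, ∀ i, 0 ≤ z i) (h0 : (0 : ℕ → ℝ) ∈ A) (h : ∀ z ∈ A, stem z ⊆ A) :
    IsContinuum A := by
  refine ⟨hA, ⟨0, h0⟩, isPreconnected_of_forall 0 fun z hz => ?_⟩
  exact ⟨stem z, h z hz, zero_mem_stem (hpos z hz), self_mem_stem (hpos z hz),
    isPreconnected_stem (hpos z hz)⟩

/-- If no one-point level is found, some `k` shares the level `t` with a different tail from `x`.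
One part omits a neighbourhood of the points above `t` with tail near that of `x`; the other is the
union of the stems of such points. The first misses `x`, the second misses `k`, and both are unions
of stems through `0`, hence connected. -/
lemma isDecomposable_of_zero_mem (hE : Dense Eᶜ) (hKE : K ⊆ branchSet E) (hK : IsContinuum K)
    (h0 : (0 : ℕ → ℝ) ∈ K) (hnt : K.Nontrivial) : IsDecomposable K := by
  have hpos : ∀ z ∈ K, ∀ i, 0 ≤ z i := fun z hz i => (hKE hz i).1
  have hst : ∀ z ∈ K, stem z ⊆ K := fun z hz =>
    stem_subset hE hKE hK.1 hK.2.isPreconnected h0 hz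
  obtain ⟨x, hx, hx0⟩ := hnt.exists_ne 0
  obtain ⟨n, hn⟩ := Function.ne_iff.1 hx0
  obtain ⟨t, htE, ht0, htx⟩ := hE.exists_between (lt_of_le_of_ne (hpos x hx n) (Ne.symm hn))
  by_cases hlev : ∀ z ∈ K, z n = t → z = cutAt x n t
  · exact isDecomposable_of_level hK (continuous_apply n) hlev h0 hx ht0 htx
  push Not at hlev
  obtain ⟨k, hk, hkt, hkne⟩ := hlev
  have hdk : ∀ z ∈ {z | z ∈ K ∧ t ≤ z n ∧ k ∈ stem z}, 0 < tailDeviation x n z := by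
    rintro z ⟨-, -, hkz⟩
    refine tailDeviation_pos fun h => hkne ?_
    refine eq_cutAt_of_mem_branchSet (hKE hk) htE hkt fun i hi => ?_
    rw [(hkz n).2.2 (by rw [hkt]; exact ht0.ne') i hi, h i hi]
  have hlec : IsClosed {z : ℕ → ℝ | t ≤ z n} := isClosed_le continuous_const (continuous_apply n)
  have hMc : IsCompact {z | z ∈ K ∧ t ≤ z n ∧ k ∈ stem z} :=
    hK.1.inter_right (hlec.inter
      (isClosed_stem_rel.preimage (continuous_const.prodMk continuous_id)))
  -- `ε` bounds from below the tail deviation of every point above `t` whose stem passes through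
  -- `k`, so the threshold `ε / 2` excludes `k` from the second part.
  obtain ⟨ε, hε, hεle⟩ := hMc.exists_forall_le' (continuous_tailDeviation x n).continuousOn hdk
  have hdc := continuous_tailDeviation x n
  refine ⟨K \ {z | t < z n ∧ tailDeviation x n z < ε / 2},
    Prod.fst '' {p : (ℕ → ℝ) × (ℕ → ℝ) | p ∈ K ×ˢ K ∧ (p.1 ∈ stem p.2 ∧ t ≤ p.2 n ∧
      tailDeviation x n p.2 ≤ ε / 2)}, ?_, ?_, ?_, ?_, ?_⟩
  · refine isContinuum_of_stem_subset (hK.1.diff ?_) (fun z hz => hpos z hz.1)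
      ⟨h0, fun h => ht0.not_gt h.1⟩ ?_
    · exact (isOpen_lt continuous_const (continuous_apply n)).inter (isOpen_lt hdc continuous_const)
    · rintro z ⟨hz, hzV⟩ w hw
      refine ⟨hst z hz hw, fun hwV => hzV ⟨hwV.1.trans_le (hw n).2.1, ?_⟩⟩
      rw [← tailDeviation_congr ((hw n).2.2 (ht0.trans hwV.1).ne')]
      exact hwV.2
  · refine isContinuum_of_stem_subset ?_ ?_ ?_ ?_
    · refine ((hK.1.prod hK.1).inter_right (isClosed_stem_rel.inter
        ((hlec.preimage continuous_snd).inter ?_))).image continuous_fst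
      exact isClosed_le (hdc.comp continuous_snd) continuous_const
    · rintro _ ⟨p, hp, rfl⟩
      exact hpos _ hp.1.1
    · exact ⟨(0, x), ⟨⟨h0, hx⟩, zero_mem_stem (hpos x hx), htx.le,
        by rw [tailDeviation_self]; positivity⟩, rfl⟩
    · rintro _ ⟨p, hp, rfl⟩ w hw
      exact ⟨(w, p.2), ⟨⟨hst _ hp.1.1 hw, hp.1.2⟩, stem_trans hw hp.2.1, hp.2.2⟩, rfl⟩
  · refine ssubset_of_subset_of_ne sdiff_subset fun h => ?_
    refine (h.symm ▸ hx : x ∈ K \ {z | t < z n ∧ tailDeviation x n z < ε / 2}).2 ⟨htx, ?_⟩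
    rw [tailDeviation_self]; positivity
  · refine ssubset_of_subset_of_ne ?_ fun h => ?_
    · rintro _ ⟨p, hp, rfl⟩
      exact hp.1.1
    · obtain ⟨p, hp, hpk⟩ := h.symm ▸ hk
      have := hεle p.2 ⟨hp.1.2, hp.2.2.1, hpk ▸ hp.2.1⟩
      linarith [hp.2.2.2]
  · refine subset_antisymm (union_subset sdiff_subset ?_) fun z hz => ?_
    · rintro _ ⟨p, hp, rfl⟩
      exact hp.1.1
    · by_cases h : t < z n ∧ tailDeviation x n z < ε / 2
      · exact Or.inr ⟨(z, z), ⟨⟨hz, hz⟩, self_mem_stem (hpos z hz), h.1.le, h.2.le⟩, rfl⟩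
      · exact Or.inl ⟨hz, h⟩

lemma isDecomposable_of_subset_branchSet (hE : Dense Eᶜ) (h0E : (0 : ℝ) ∉ E)
    (hKE : K ⊆ branchSet E) (hK : IsContinuum K) (hnt : K.Nontrivial) : IsDecomposable K := by
  by_cases h0 : (0 : ℕ → ℝ) ∈ K
  · exact isDecomposable_of_zero_mem hE hKE hK h0 hnt
  · obtain ⟨n, t, a, ha, b, hb, y, -, hat, htb, -, hy⟩ :=
      exists_level hE h0E hKE hK.1 hK.2.isPreconnected h0 hnt
    exact isDecomposable_of_level hK (continuous_apply n) hy ha hb hat htb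

end Branch

/-! ### Unique arcs and finite trees. -/

section Tree

lemma isArcBetween_coe_iff {Y : Type*} [TopologicalSpace Y] {T : Set Y} {B : Set T} {p q : T} :
    IsArcBetween (Subtype.val '' B) (p : Y) (q : Y) ↔ IsArcBetween B p q := by
  constructor
  · rintro ⟨k, hk, hr, h0, h1⟩
    have hT : ∀ s, k s ∈ T := fun s => by
      obtain ⟨z, -, hz⟩ := hr ▸ mem_range_self (f := k) s
      exact hz ▸ z.2
    refine ⟨fun s => ⟨k s, hT s⟩, hk.codRestrict T hT, ?_, Subtype.ext h0, Subtype.ext h1⟩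
    apply Subtype.val_injective.image_injective
    rw [← range_comp, ← hr]
    rfl
  · rintro ⟨k, hk, rfl, rfl, rfl⟩
    exact ⟨Subtype.val ∘ k, IsEmbedding.subtypeVal.comp hk, range_comp _ _, rfl, rfl⟩

lemma isTopologicalTree_coe {Y : Type*} [TopologicalSpace Y] [TopologicalSpace.MetrizableSpace Y]
    {T : Set Y} (hne : T.Nonempty) {𝒜 : Set (Set Y)} (hfin : 𝒜.Finite)
    (harc : ∀ A ∈ 𝒜, A ⊆ T ∧ ∃ p q, IsArcBetween A p q) (hcov : T ⊆ ⋃₀ 𝒜)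
    (huniq : ∀ p ∈ T, ∀ q ∈ T, p ≠ q → ∃ A ⊆ T, IsArcBetween A p q ∧
      ∀ B ⊆ T, IsArcBetween B p q → B = A) : IsTopologicalTree T := by
  have himg : ∀ A ⊆ T, Subtype.val '' (Subtype.val ⁻¹' A : Set T) = A := fun A hA => by
    rwa [Subtype.image_preimage_coe, inter_eq_right]
  refine ⟨hne.to_subtype, ⟨(fun A => Subtype.val ⁻¹' A) '' 𝒜, hfin.image _, ?_, ?_⟩, ?_⟩
  · rintro _ ⟨A, hA, rfl⟩
    obtain ⟨hAT, p, q, h⟩ := harc A hA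
    refine ⟨⟨p, hAT h.left_mem⟩, ⟨q, hAT h.right_mem⟩, ?_⟩
    rw [← isArcBetween_coe_iff, himg A hAT]
    exact h
  · refine eq_univ_of_forall fun z => ?_
    obtain ⟨A, hA, hz⟩ := hcov z.2
    exact ⟨_, ⟨A, hA, rfl⟩, hz⟩
  · rintro p q hpq
    obtain ⟨A, hAT, hA, hu⟩ := huniq p p.2 q q.2 fun h => hpq (Subtype.ext h)
    refine ⟨Subtype.val ⁻¹' A, ?_, fun B hB => ?_⟩
    · change IsArcBetween _ p q
      rw [← isArcBetween_coe_iff, himg A hAT]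
      exact hA
    · rw [← hu _ (Subtype.coe_image_subset T B) (isArcBetween_coe_iff.2 hB),
        preimage_image_eq _ Subtype.val_injective]

lemma upper_stem_subset {B S : Set (ℕ → ℝ)} {p u : ℕ → ℝ} (hu : ∀ i, 0 ≤ u i) (hB : IsClosed B)
    (huB : u ∈ B) (hp : p ∈ stem u) (hsub : stem u ⊆ B ∪ S)
    (hS : ∀ w ∈ stem u, height p ≤ height w → w ∈ S → w = p) :
    stem u ∩ {w | height p ≤ height w} ⊆ B := by
  have h1 : ∀ w ∈ stem u ∩ {w | height p ≤ height w}, w ≠ p → w ∈ B := fun w hw hne =>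
    (hsub hw.1).elim id fun h => absurd (hS w hw.1 hw.2 h) hne
  intro w hw
  by_cases hwp : w = p
  · subst hwp
    by_cases hwu : w = u
    · rwa [hwu]
    · have hpc := (isPreconnected_stem hu).inter_le_of_level continuous_height (t := height w)
        (y := w) fun z hz h => injOn_height_stem u hz hp h
      have hacc := hpc.preperfect_of_nontrivial ⟨w, hw, u, ⟨self_mem_stem hu,
        strictMono_height.monotone fun n => (hp n).2.1⟩, hwu⟩ w hw
      rw [accPt_principal_iff_clusterPt, ← mem_closure_iff_clusterPt] at hacc
      exact closure_minimal (fun z hz => h1 z hz.1 hz.2) hB hacc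
  · exact h1 w hw hwp

variable {E : Set ℝ} {T : Set (ℕ → ℝ)}

/-- Let `p` be the highest common point of the two stems; the arc runs from `u` down to `p` and up
to `v`. For any arc `B` from `u` to `v`, the union `B ∪ stem v` is a continuum through `0`, so it
contains `stem u`, and `B` contains the part of `stem u` above `p`; symmetrically for `v`. -/
lemma exists_unique_arc (hE : Dense Eᶜ) (hT : T ⊆ branchSet E) (hst : ∀ u ∈ T, stem u ⊆ T)
    {u v : ℕ → ℝ} (hu : u ∈ T) (hv : v ∈ T) (huv : u ≠ v) :
    ∃ A ⊆ T, IsArcBetween A u v ∧ ∀ B ⊆ T, IsArcBetween B u v → B = A := by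
  classical
  have hu0 : ∀ i, 0 ≤ u i := fun i => (hT hu i).1
  have hv0 : ∀ i, 0 ≤ v i := fun i => (hT hv i).1
  obtain ⟨p, ⟨hpu, hpv⟩, hpmax⟩ := ((isCompact_stem u).inter (isCompact_stem v)).exists_isMaxOn
    ⟨0, zero_mem_stem hu0, zero_mem_stem hv0⟩ continuous_height.continuousOn
  have hle : ∀ w, w ∈ stem u → w ∈ stem v → height w ≤ height p := fun w h1 h2 => hpmax ⟨h1, h2⟩
  have hpc : ∀ x : ℕ → ℝ, (∀ i, 0 ≤ x i) → p ∈ stem x →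
      IsPreconnected (stem x ∩ {w | height p ≤ height w}) := fun x hx hp =>
    (isPreconnected_stem hx).inter_le_of_level continuous_height
      fun z hz h => injOn_height_stem x hz hp h
  have hcl : IsClosed {w | height p ≤ height w} := isClosed_le continuous_const continuous_height
  set Au := stem u ∩ {w | height p ≤ height w} with hAu
  set Av := stem v ∩ {w | height p ≤ height w} with hAv
  have hApre : IsPreconnected (Au ∪ Av) := IsPreconnected.union p ⟨hpu, le_refl (height p)⟩
    ⟨hpv, le_refl (height p)⟩ (hpc u hu0 hpu) (hpc v hv0 hpv)
  have huA : u ∈ Au := ⟨self_mem_stem hu0, strictMono_height.monotone fun n => (hpu n).2.1⟩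
  have hvA : v ∈ Av := ⟨self_mem_stem hv0, strictMono_height.monotone fun n => (hpv n).2.1⟩
  -- Signed height above `p`, positive on the side of `u` and negative on the side of `v`; the two
  -- sides meet only at `p`.
  let τ : (ℕ → ℝ) → ℝ := fun w => if w ∈ stem u then height w - height p else height p - height w
  have hτu : ∀ w ∈ Au, τ w = height w - height p := fun w hw => if_pos hw.1
  have hτv : ∀ w ∈ Av, τ w = height p - height w := fun w hw => by
    by_cases h : w ∈ stem u
    · have := le_antisymm (hle w h hw.1) hw.2
      simp [τ, h, this]
    · exact if_neg h
  have hinj : InjOn τ (Au ∪ Av) := by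
    have hmix : ∀ w ∈ Au, ∀ z ∈ Av, τ w = τ z → w = z := fun w hw z hz h => by
      rw [hτu w hw, hτv z hz] at h
      have h1 : height p ≤ height w := hw.2
      have h2 : height p ≤ height z := hz.2
      rw [injOn_height_stem u hw.1 hpu (by linarith), injOn_height_stem v hz.1 hpv (by linarith)]
    rintro w (hw | hw) z (hz | hz) h
    · rw [hτu w hw, hτu z hz] at h
      exact injOn_height_stem u hw.1 hz.1 (by linarith)
    · exact hmix w hw z hz h
    · exact (hmix z hz w hw h.symm).symm
    · rw [hτv w hw, hτv z hz] at h
      exact injOn_height_stem v hw.1 hz.1 (by linarith)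
  have hcont : ContinuousOn τ (Au ∪ Av) := by
    refine ContinuousOn.union_of_isClosed
      ((continuous_height.sub continuous_const).continuousOn.congr hτu)
      ((continuous_const.sub continuous_height).continuousOn.congr hτv)
      ((isCompact_stem u).isClosed.inter hcl) ((isCompact_stem v).isClosed.inter hcl)
  have harc : IsArcBetween (Au ∪ Av) v u := by
    refine isArcBetween_of_injOn (((isCompact_stem u).inter_right hcl).union
      ((isCompact_stem v).inter_right hcl)) hApre hcont hinj (Or.inr hvA) (Or.inl huA) huv.symm ?_
    rw [hτu u huA, hτv v hvA]
    have h1 : height p ≤ height u := huA.2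
    have h2 : height p ≤ height v := hvA.2
    rintro z (hz | hz)
    · have h3 : height p ≤ height z := hz.2
      have h4 : height z ≤ height u := strictMono_height.monotone fun n => (hz.1 n).2.1
      rw [hτu z hz]
      constructor <;> linarith
    · have h3 : height p ≤ height z := hz.2
      have h4 : height z ≤ height v := strictMono_height.monotone fun n => (hz.1 n).2.1
      rw [hτv z hz]
      constructor <;> linarith
  refine ⟨Au ∪ Av, union_subset (inter_subset_left.trans (hst u hu))
    (inter_subset_left.trans (hst v hv)), harc.symm, fun B hBT hB => ?_⟩
  have hsub : ∀ x y, x ∈ B → y ∈ B → stem x ⊆ B ∪ stem y := fun x y hx hy => by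
    have hy0 : ∀ i, 0 ≤ y i := fun i => (hT (hBT hy) i).1
    exact stem_subset hE ((union_subset hBT (hst y (hBT hy))).trans hT)
      (hB.isCompact.union (isCompact_stem y))
      (hB.isPreconnected.union y hy (self_mem_stem hy0) (isPreconnected_stem hy0))
      (Or.inr (zero_mem_stem hy0)) (Or.inl hx)
  refine (hB.eq_of_subset hApre (union_subset ?_ ?_) (Or.inl huA) (Or.inr hvA)).symm
  · exact upper_stem_subset hu0 hB.isCompact.isClosed hB.left_mem hpu
      (hsub u v hB.left_mem hB.right_mem) fun w hw h1 h2 =>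
        injOn_height_stem u hw hpu (le_antisymm (hle w hw h2) h1)
  · exact upper_stem_subset hv0 hB.isCompact.isClosed hB.right_mem hpv
      (hsub v u hB.right_mem hB.left_mem) fun w hw h1 h2 =>
        injOn_height_stem v hw hpv (le_antisymm (hle w h2 hw) h1)

/-- For each `n ≤ k` only finitely many tails after `n` occur with a nonzero `n`-th coordinate. The
stem of a point with the largest `n`-th coordinate for a given tail covers every point with that
tail whose first nonzero coordinate is `n`. -/
lemma isTopologicalTree_of_finite (hE : E.Finite) (hT : T ⊆ branchSet E) (hTc : IsCompact T)
    (hst : ∀ u ∈ T, stem u ⊆ T) {k : ℕ} (hk : ∀ u ∈ T, ∀ n, k < n → u n = 0)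
    {o : ℕ → ℝ} (ho : o ∈ T) (ho0 : o ≠ 0) : IsTopologicalTree T := by
  classical
  have hE' : Dense Eᶜ := hE.countable.dense_compl ℝ
  let θ : ℕ → (ℕ → ℝ) → ℕ → ℝ := fun n u i => if n < i then u i else 0
  have hθ : ∀ n, Continuous (θ n) := fun n => continuous_pi fun i => by
    by_cases h : n < i
    · simpa only [θ, h, if_true] using continuous_apply i
    · simpa only [θ, h, if_false] using continuous_const
  have hfin : ∀ n, (θ n '' (T ∩ {u | u n ≠ 0})).Finite := fun n => by
    refine ((Set.Finite.pi' fun _ : Fin (k + 1) => hE.insert 0).image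
      fun g i => if h : i < k + 1 then g ⟨i, h⟩ else 0).subset ?_
    rintro _ ⟨u, ⟨hu, hun⟩, rfl⟩
    refine ⟨fun i => θ n u i, fun i => ?_, ?_⟩
    · by_cases h : n < i
      · simp only [θ, h, if_true]
        exact Or.inr ((hT hu n).2 hun i h)
      · simp [θ, h]
    · ext i
      by_cases h : i < k + 1
      · simp [h]
      · simp [h, θ, hk u hu i (by omega)]
  have hmax : ∀ n τ, τ ∈ θ n '' T → ∃ e ∈ T, θ n e = τ ∧ ∀ u ∈ T, θ n u = τ → u n ≤ e n := by
    rintro n _ ⟨u, hu, rfl⟩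
    obtain ⟨e, he, hmax⟩ := (hTc.inter_right (isClosed_singleton (x := θ n u) |>.preimage
      (hθ n))).exists_isMaxOn ⟨u, hu, rfl⟩ (continuous_apply n).continuousOn
    exact ⟨e, he.1, he.2, fun w hw h => hmax ⟨hw, h⟩⟩
  choose! e heT heθ hemax using hmax
  have hcov : ∀ u ∈ T, u ≠ 0 → ∃ n ≤ k, u n ≠ 0 ∧ u ∈ stem (e n (θ n u)) := by
    intro u hu hu0
    obtain ⟨n, hn, hlt⟩ := exists_eq_zero_of_lt hu0
    have hm : θ n u ∈ θ n '' T := ⟨u, hu, rfl⟩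
    refine ⟨n, not_lt.1 fun h => hn (hk u hu n h), hn, ?_⟩
    have hi : ∀ i, n < i → u i = e n (θ n u) i := fun i hi => by
      have := congrFun (heθ n _ hm) i
      simpa [θ, hi] using this.symm
    have heq : cutAt (e n (θ n u)) n (u n) = u := (eq_cutAt hlt rfl hi).symm
    have hmem : cutAt (e n (θ n u)) n (u n) ∈ stem (e n (θ n u)) := cutAt_mem_stem (fun i => (hT (heT n _ hm) i).1) (hT hu n).1 (hemax n _ hm u hu rfl)
    rwa [heq] at hmem
  refine isTopologicalTree_coe ⟨o, ho⟩ (𝒜 := stem '' ⋃ n ∈ {n | n ≤ k},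
    e n '' (θ n '' (T ∩ {u | u n ≠ 0}))) (((finite_le_nat k).biUnion fun n _ =>
      (hfin n).image _).image _) ?_ ?_ fun p hp q hq hpq => exists_unique_arc hE' hT hst hp hq hpq
  · rintro _ ⟨x, hx, rfl⟩
    obtain ⟨n, -, _, ⟨u, ⟨hu, hun⟩, rfl⟩, rfl⟩ := mem_iUnion₂.1 hx
    have hm : θ n u ∈ θ n '' T := ⟨u, hu, rfl⟩
    refine ⟨hst _ (heT n _ hm), 0, _, isArcBetween_stem (fun i => (hT (heT n _ hm) i).1) fun h => ?_⟩
    have h1 := hemax n _ hm u hu rfl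
    rw [h] at h1
    exact hun (le_antisymm h1 (hT hu n).1)
  · have hmem : ∀ u ∈ T, u ≠ 0 → ∃ A ∈ stem '' ⋃ n ∈ {n | n ≤ k},
        e n '' (θ n '' (T ∩ {u | u n ≠ 0})), u ∈ A := fun u hu hu0 => by
      obtain ⟨n, hnk, hn, h⟩ := hcov u hu hu0
      exact ⟨_, ⟨_, mem_iUnion₂.2 ⟨n, hnk, _, ⟨u, ⟨hu, hn⟩, rfl⟩, rfl⟩, rfl⟩, h⟩
    intro u hu
    by_cases hu0 : u = 0
    · subst hu0
      obtain ⟨_, ⟨x, hx, rfl⟩, hox⟩ := hmem o ho ho0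
      exact ⟨_, ⟨x, hx, rfl⟩, zero_mem_stem fun i => (hox i).1.trans (hox i).2.1⟩
    · exact hmem u hu hu0

end Tree

/-! ### Inverse limits of quotients. -/

/-- A compact set with a sequence of finer and finer continuous maps onto trees that jointly
separate points is tree-like. -/
lemma isTreeLike_of_quotients {Y : Type*} [TopologicalSpace Y]
    [TopologicalSpace.MetrizableSpace Y] {K : Set Y} (hK : IsCompact K) {q : ℕ → Y → ℕ → ℝ}
    (hq : ∀ n, Continuous (q n)) (hinj : ∀ x ∈ K, ∀ y ∈ K, (∀ n, q n x = q n y) → x = y)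
    (href : ∀ n x y, q (n + 1) x = q (n + 1) y → q n x = q n y)
    (htree : ∀ n, IsTopologicalTree (q n '' K)) : IsTreeLike K := by
  have : CompactSpace K := isCompact_iff_compactSpace.1 hK
  let π : ∀ n, K → q n '' K := fun n x => ⟨q n x, mem_image_of_mem _ x.2⟩
  have hπ : ∀ n, Continuous (π n) := fun n =>
    ((hq n).comp continuous_subtype_val).subtype_mk _
  have hπs : ∀ n, Function.Surjective (π n) := by
    rintro n ⟨_, x, hx, rfl⟩
    exact ⟨⟨x, hx⟩, rfl⟩
  -- The choice of preimage is immaterial by `href`, and continuity descends through the quotient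
  -- map `π (n + 1)`.
  let g : ∀ n, q (n + 1) '' K → q n '' K := fun n t => π n (Function.surjInv (hπs (n + 1)) t)
  have hg : ∀ n x, g n (π (n + 1) x) = π n x := fun n x =>
    Subtype.ext (href n _ _ (congrArg Subtype.val (Function.surjInv_eq (hπs (n + 1)) _)))
  have hgc : ∀ n, Continuous (g n) := fun n => by
    have hqm := (hπ (n + 1)).isClosedMap.isQuotientMap (hπ (n + 1)) (hπs (n + 1))
    rw [hqm.continuous_iff]
    exact (hπ n).congr fun x => (hg n x).symm
  refine ⟨fun n => q n '' K, inferInstance, inferInstance, g, htree, hgc, ?_⟩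
  let Φ : K → setInverseLimit (X := fun n => q n '' K)
      (fun n (t : q (n + 1) '' K) => ({g n t} : Set (q n '' K))) :=
    fun x => ⟨fun n => π n x, fun n => (hg n x).symm⟩
  have hΦ : Continuous Φ := (continuous_pi fun n => hπ n).subtype_mk _
  have hb : Function.Bijective Φ := by
    constructor
    · intro x y h
      exact Subtype.ext (hinj x x.2 y y.2 fun n =>
        congrArg Subtype.val (congrFun (congrArg Subtype.val h) n))
    · rintro ⟨z, hz⟩
      have hcl : ∀ n, IsClosed (π n ⁻¹' {z n}) := fun n => isClosed_singleton.preimage (hπ n)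
      -- A thread of the inverse limit determines a decreasing sequence of nonempty compact fibres.
      obtain ⟨x, hx⟩ := IsCompact.nonempty_iInter_of_sequence_nonempty_isCompact_isClosed
        (fun n => π n ⁻¹' {z n}) (fun n x hx => by
          have h1 : π (n + 1) x = z (n + 1) := hx
          have h2 : z n = g n (z (n + 1)) := hz n
          change π n x = z n
          rw [h2, ← h1, hg]) (fun n => hπs n (z n)) (hcl 0).isCompact hcl
      exact ⟨x, Subtype.ext (funext fun n => mem_iInter.1 hx n)⟩
  exact ⟨Continuous.homeoOfEquivCompactToT2 (f := Equiv.ofBijective Φ hb) hΦ⟩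

/-! ### Collapsing maps that make `E` finite. -/

section Collapse

/-- A monotone function that is constant near each point of `E`. -/
noncomputable def collapse (E : Set ℝ) (k : ℕ) (t : ℝ) : ℝ :=
  ∫ s in (0 : ℝ)..t, max 0 (Metric.infDist s E - 1 / (k + 1))

variable {E : Set ℝ} {k : ℕ} {s t : ℝ}

lemma continuous_collapse_integrand (E : Set ℝ) (k : ℕ) :
    Continuous fun s => max 0 (Metric.infDist s E - 1 / ((k : ℝ) + 1)) :=
  continuous_const.max ((Metric.continuous_infDist_pt E).sub continuous_const)

lemma collapse_sub (E : Set ℝ) (k : ℕ) (s t : ℝ) : collapse E k t - collapse E k s =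
    ∫ r in s..t, max 0 (Metric.infDist r E - 1 / ((k : ℝ) + 1)) :=
  intervalIntegral.integral_interval_sub_left
    ((continuous_collapse_integrand E k).intervalIntegrable _ _)
    ((continuous_collapse_integrand E k).intervalIntegrable _ _)

lemma collapse_zero : collapse E k 0 = 0 := intervalIntegral.integral_same

lemma collapse_mono : Monotone (collapse E k) := fun s t h => by
  rw [← sub_nonneg, collapse_sub]
  exact intervalIntegral.integral_nonneg h fun _ _ => le_max_left _ _

lemma continuous_collapse : Continuous (collapse E k) :=
  intervalIntegral.continuous_primitive
    (fun _ _ => (continuous_collapse_integrand E k).intervalIntegrable _ _) 0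

/-- The integrand vanishes within `1 / (k + 1)` of `E`, so the collapse is constant on each of the
finitely many balls of that radius, centred in `E`, that cover `E`. -/
lemma finite_image_collapse (hE : IsCompact E) (k : ℕ) : (collapse E k '' E).Finite := by
  have hk : (0 : ℝ) < 1 / ((k : ℝ) + 1) := by positivity
  obtain ⟨F, hFE, hF⟩ := hE.elim_nhds_subcover (fun c => Metric.ball c (1 / ((k : ℝ) + 1)))
    fun c _ => Metric.ball_mem_nhds c hk
  refine (F.finite_toSet.image (collapse E k)).subset ?_
  rintro _ ⟨t, ht, rfl⟩
  obtain ⟨c, hc, htc⟩ := mem_iUnion₂.1 (hF ht)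
  refine ⟨c, hc, ?_⟩
  rw [← sub_eq_zero, collapse_sub, intervalIntegral.integral_congr (g := fun _ => (0 : ℝ))]
  · simp
  · intro r hr
    have h1 : Metric.infDist r E ≤ dist r c := Metric.infDist_le_dist_of_mem (hFE c hc)
    have h2 : dist r c ≤ dist t c := by
      rw [Real.dist_eq, Real.dist_eq]
      exact abs_sub_left_of_mem_uIcc (uIcc_comm t c ▸ hr)
    exact max_eq_left (by linarith [Metric.mem_ball.1 htc])

/-- The integrand grows with `k`, so a vanishing integral at stage `k + 1` forces one at stage `k`.
-/
lemma collapse_eq_of_succ (h : collapse E (k + 1) s = collapse E (k + 1) t) :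
    collapse E k s = collapse E k t := by
  wlog hst : s ≤ t generalizing s t
  · exact (this h.symm (le_of_not_ge hst)).symm
  refine le_antisymm (collapse_mono hst) (sub_nonpos.1 ?_)
  rw [← sub_eq_zero.2 h.symm, collapse_sub, collapse_sub]
  refine intervalIntegral.integral_mono_on hst
    ((continuous_collapse_integrand E k).intervalIntegrable _ _)
    ((continuous_collapse_integrand E (k + 1)).intervalIntegrable _ _) fun r _ =>
    max_le_max le_rfl (sub_le_sub_left ?_ _)
  exact one_div_le_one_div_of_le (by positivity) (by push_cast; linarith)

lemma eventually_collapse_lt (hE : IsClosed E) (hne : E.Nonempty) (hd : Dense Eᶜ) (h : s < t) :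
    ∀ᶠ k in atTop, collapse E k s < collapse E k t := by
  obtain ⟨c, hcE, hc⟩ := hd.exists_between h
  have hpos := (hE.notMem_iff_infDist_pos hne).1 hcE
  filter_upwards [tendsto_one_div_add_atTop_nhds_zero_nat.eventually (gt_mem_nhds hpos)] with k hk
  rw [← sub_pos, collapse_sub]
  exact intervalIntegral.integral_pos h (continuous_collapse_integrand E k).continuousOn
    (fun _ _ => le_max_left _ _) ⟨c, ⟨hc.1.le, hc.2.le⟩, lt_max_of_lt_right (sub_pos.2 hk)⟩

/-- Collapse the first coordinates of a sequence and drop the others. -/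
noncomputable def squash (E : Set ℝ) (k : ℕ) (x : ℕ → ℝ) : ℕ → ℝ :=
  fun n => if n ≤ k then collapse E k (x n) else 0

variable {x y : ℕ → ℝ} {n : ℕ}

lemma squash_of_le (h : n ≤ k) : squash E k x n = collapse E k (x n) := if_pos h

lemma squash_of_lt (h : k < n) : squash E k x n = 0 := if_neg h.not_ge

lemma continuous_squash : Continuous (squash E k) := continuous_pi fun n => by
  by_cases h : n ≤ k
  · simp only [squash_of_le h]
    exact continuous_collapse.comp (continuous_apply n)
  · simp only [squash_of_lt (not_le.1 h)]
    exact continuous_const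

lemma squash_eq_of_succ (h : squash E (k + 1) x = squash E (k + 1) y) :
    squash E k x = squash E k y := by
  ext n
  by_cases hn : n ≤ k
  · have := congrFun h n
    rw [squash_of_le (by omega), squash_of_le (by omega)] at this
    rw [squash_of_le hn, squash_of_le hn, collapse_eq_of_succ this]
  · rw [squash_of_lt (not_le.1 hn), squash_of_lt (not_le.1 hn)]

lemma eventually_squash_ne (hE : IsClosed E) (hne : E.Nonempty) (hd : Dense Eᶜ) (h : x ≠ y) :
    ∀ᶠ k in atTop, squash E k x ≠ squash E k y := by
  obtain ⟨n, hn⟩ := Function.ne_iff.1 h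
  have : ∀ᶠ k in atTop, collapse E k (x n) ≠ collapse E k (y n) := by
    rcases lt_or_gt_of_ne hn with h | h
    · exact (eventually_collapse_lt hE hne hd h).mono fun k hk => hk.ne
    · exact (eventually_collapse_lt hE hne hd h).mono fun k hk => hk.ne'
  filter_upwards [this, eventually_ge_atTop n] with k h1 h2 h3
  have := congrFun h3 n
  rw [squash_of_le h2, squash_of_le h2] at this
  exact h1 this

lemma squash_zero : squash E k 0 = 0 := by
  ext n
  by_cases h : n ≤ k
  · rw [squash_of_le h]; exact collapse_zero
  · rw [squash_of_lt (not_le.1 h)]; rfl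

lemma squash_nonneg (hx : ∀ i, 0 ≤ x i) (n : ℕ) : 0 ≤ squash E k x n := by
  by_cases h : n ≤ k
  · rw [squash_of_le h, ← collapse_zero (E := E) (k := k)]
    exact collapse_mono (hx n)
  · rw [squash_of_lt (not_le.1 h)]

/-- The value `0` is adjoined because the dropped coordinates become zero. -/
lemma squash_mem_branchSet (hx : x ∈ branchSet E) :
    squash E k x ∈ branchSet (insert 0 (collapse E k '' E)) := by
  refine fun n => ⟨squash_nonneg (fun i => (hx i).1) n, fun hn i hi => ?_⟩
  by_cases hik : i ≤ k
  · rw [squash_of_le hik]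
    rw [squash_of_le (by omega)] at hn
    exact Or.inr (mem_image_of_mem _ ((hx n).2 (fun h => hn (by rw [h, collapse_zero])) i hi))
  · rw [squash_of_lt (not_le.1 hik)]
    exact Or.inl rfl

/-- The height of a cut lifts through the monotone collapse by the intermediate value theorem. -/
lemma stem_squash_subset (hx : ∀ i, 0 ≤ x i) : stem (squash E k x) ⊆ squash E k '' stem x := by
  intro v hv
  by_cases hv0 : v = 0
  · exact ⟨0, zero_mem_stem hx, by rw [hv0, squash_zero]⟩
  obtain ⟨n, h1, h2, h3⟩ := exists_eq_cutAt hv hv0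
  have hnk : n ≤ k := not_lt.1 fun h => by rw [squash_of_lt h] at h2; linarith
  rw [squash_of_le hnk] at h2
  obtain ⟨s, hs, hsv⟩ := intermediate_value_Icc (hx n) (continuous_collapse (E := E)
    (k := k)).continuousOn ⟨collapse_zero.trans_le h1.le, h2⟩
  refine ⟨cutAt x n s, cutAt_mem_stem hx hs.1 hs.2, ?_⟩
  rw [h3]
  refine eq_cutAt (fun i hi => ?_) ?_ fun i hi => ?_
  · rw [squash_of_le (by omega), cutAt_of_lt hi, collapse_zero]
  · rw [squash_of_le hnk, cutAt_self, hsv]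
  · simp only [squash, cutAt_of_gt hi]

lemma isTopologicalTree_squash_image (hE : IsCompact E) {Z : Set (ℕ → ℝ)} (hZ : IsCompact Z)
    (hZE : Z ⊆ branchSet E) (hst : ∀ z ∈ Z, stem z ⊆ Z) {o : ℕ → ℝ} (ho : o ∈ Z)
    (ho0 : squash E k o ≠ 0) : IsTopologicalTree (squash E k '' Z) := by
  refine isTopologicalTree_of_finite ((finite_image_collapse hE k).insert 0) ?_
    (hZ.image continuous_squash) ?_ (k := k) ?_ (mem_image_of_mem _ ho) ho0
  · rintro _ ⟨z, hz, rfl⟩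
    exact squash_mem_branchSet (hZE hz)
  · rintro _ ⟨z, hz, rfl⟩
    exact (stem_squash_subset fun i => (hZE hz i).1).trans (image_mono (hst z hz))
  · rintro _ ⟨z, hz, rfl⟩ n hn
    exact squash_of_lt hn

end Collapse

/-! ### The embedding of the limit by its defects. -/

lemma isPreconnected_of_image {Y Z : Type*} [TopologicalSpace Y] [TopologicalSpace Z] [T2Space Z]
    {A S : Set Y} {g : Y → Z} (hA : IsCompact A) (hg : Continuous g) (hi : InjOn g A) (hS : S ⊆ A)
    (h : IsPreconnected (g '' S)) : IsPreconnected S := by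
  have : CompactSpace A := isCompact_iff_compactSpace.1 hA
  have hemb : IsClosedEmbedding fun a : A => g a :=
    (hg.comp continuous_subtype_val).isClosedEmbedding fun a b hab => Subtype.ext (hi a.2 b.2 hab)
  have hSv : Subtype.val '' (Subtype.val ⁻¹' S : Set A) = S := by
    rwa [Subtype.image_preimage_coe, inter_eq_right]
  rw [← hSv]
  refine IsPreconnected.image ?_ _ continuous_subtype_val.continuousOn
  rw [← hemb.isInducing.isPreconnected_image]
  rwa [← hSv, image_image] at h

/-- The sequence of the differences `x n - f (x (n + 1))`. -/
def defect (f : unitInterval → unitInterval) (x : ℕ → unitInterval) : ℕ → ℝ :=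
  fun n => (x n : ℝ) - f (x (n + 1))

section Limit

variable {C : Icc (0 : ℚ) 1 → Set unitInterval} {f : unitInterval → unitInterval}
  {x y : ℕ → unitInterval} {n : ℕ}

lemma IsNestedCantorFamily.subset_zero (hC : IsNestedCantorFamily C) (r : Icc (0 : ℚ) 1) :
    C r ⊆ C 0 := by
  rcases r.2.1.eq_or_lt with h | h
  · rw [show r = 0 from Subtype.ext h.symm]
  · exact (hC.2.2 r 0 h).1.1

lemma IsNestedCantorFamily.isClosed (hC : IsNestedCantorFamily C) (r : Icc (0 : ℚ) 1) :
    IsClosed (C r) := (hC.1 r).2.1.closed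

lemma IsNestedCantorFamily.zero_notMem (hC : IsNestedCantorFamily C) : (0 : unitInterval) ∉ C 0 :=
  fun h => lt_irrefl _ (hC.2.1 0 0 h)

lemma IsNestedCantorFamily.dense_compl (hC : IsNestedCantorFamily C) :
    Dense ((Subtype.val '' C 0 : Set ℝ)ᶜ) := by
  rw [← interior_eq_empty_iff_dense_compl, eq_empty_iff_forall_notMem]
  intro t ht
  have hsub : (Subtype.val ⁻¹' interior (Subtype.val '' C 0 : Set ℝ) : Set unitInterval) ⊆ C 0 := by
    rintro s hs
    obtain ⟨s', hs', h⟩ := interior_subset hs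
    exact Subtype.ext h ▸ hs'
  have hint : interior (C 0) = ∅ := by
    have := (hC.1 0).2.2
    rwa [IsNowhereDense, (hC.isClosed 0).closure_eq] at this
  obtain ⟨s, -, rfl⟩ := interior_subset ht
  have := interior_maximal hsub (isOpen_interior.preimage continuous_subtype_val) ht
  rw [hint] at this
  exact this

lemma IsAdmissibleBase.map_mem (hf : IsAdmissibleBase C f) {t : unitInterval} (ht : t ∈ C 0) :
    f t = 0 := hf.2.1 t (Or.inr ht)

lemma IsAdmissibleBase.map_zero (hf : IsAdmissibleBase C f) : f 0 = 0 := hf.2.1 0 (Or.inl rfl)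

lemma IsAdmissibleBase.map_le (hf : IsAdmissibleBase C f) (t : unitInterval) : f t ≤ t := by
  rcases (unitInterval.nonneg' (t := t)).eq_or_lt with h | h
  · rw [← h, hf.map_zero]
  · exact (hf.2.2.2 t h).le

/-- Because the `C r` decrease in `r`, the bound by the supremum becomes a family of conditions, one
for each rational `r`, each closed in `(t, s)`. This gives the closedness of `X`. -/
lemma mem_cantorBonding_iff (hC : IsNestedCantorFamily C) (hf : IsAdmissibleBase C f)
    {t s : unitInterval} : s ∈ cantorBonding C f t ↔
      s = f t ∨ t ∈ C 0 ∧ ∀ r : Icc (0 : ℚ) 1, ((r : ℚ) : ℝ) < s → t ∈ C r := by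
  by_cases ht : t ∈ C 0
  · set R := {ρ : ℝ | ∃ r : Icc (0 : ℚ) 1, t ∈ C r ∧ ρ = ((r : ℚ) : ℝ)} with hR
    have h0R : (0 : ℝ) ∈ R := ⟨0, ht, by simp⟩
    have hbd : BddAbove R := by
      refine ⟨1, ?_⟩
      rintro _ ⟨r, -, rfl⟩
      exact_mod_cast r.2.2
    simp only [cantorBonding, if_pos ht, hf.map_mem ht]
    change (s : ℝ) ≤ sSup R ↔ _
    constructor
    · refine fun h => Or.inr ⟨ht, fun r hr => ?_⟩
      obtain ⟨_, ⟨r', hr', rfl⟩, hlt⟩ := exists_lt_of_lt_csSup ⟨0, h0R⟩ (hr.trans_le h)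
      exact (hC.2.2 r' r (by exact_mod_cast hlt)).1.1 hr'
    · rintro (rfl | ⟨-, h⟩)
      · simpa using le_csSup hbd h0R
      · refine le_of_forall_lt fun c hc => ?_
        rcases lt_or_ge c 0 with hc0 | hc0
        · exact hc0.trans_le (le_csSup hbd h0R)
        obtain ⟨q, hq1, hq2⟩ := exists_rat_btwn hc
        have hq0 : (0 : ℝ) ≤ q := hc0.trans hq1.le
        have hq3 : (q : ℝ) ≤ 1 := hq2.le.trans s.2.2
        let r : Icc (0 : ℚ) 1 := ⟨q, by exact_mod_cast hq0, by exact_mod_cast hq3⟩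
        exact hq1.trans_le (le_csSup hbd ⟨r, h r hq2, rfl⟩)
  · simp [cantorBonding, ht]

lemma isClosed_cantorLimit (hC : IsNestedCantorFamily C) (hf : IsAdmissibleBase C f) :
    IsClosed (cantorLimit C f) := by
  have h1 : ∀ n : ℕ, Continuous fun x : ℕ → unitInterval => x n := continuous_apply
  have h : cantorLimit C f = ⋂ n : ℕ, ({x | x n = f (x (n + 1))} ∪
      ({x | x (n + 1) ∈ C 0} ∩ ⋂ r : Icc (0 : ℚ) 1,
        ({x | (x n : ℝ) ≤ ((r : ℚ) : ℝ)} ∪ {x | x (n + 1) ∈ C r}))) := by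
    ext x
    simp [cantorLimit, setInverseLimit, mem_cantorBonding_iff hC hf, or_iff_not_imp_left]
  rw [h]
  refine isClosed_iInter fun n => (isClosed_eq (h1 n) (hf.1.comp (h1 _))).union
    (((hC.isClosed 0).preimage (h1 (n + 1))).inter (isClosed_iInter fun r => ?_))
  exact (isClosed_le (continuous_subtype_val.comp (h1 n)) continuous_const).union
    ((hC.isClosed r).preimage (h1 (n + 1)))

lemma cantorLimit_cases (hx : x ∈ cantorLimit C f) (n : ℕ) :
    x n = f (x (n + 1)) ∨ x (n + 1) ∈ C 0 := by
  by_cases h : x (n + 1) ∈ C 0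
  · exact Or.inr h
  · have := hx n
    simp only [cantorBonding, if_neg h] at this
    exact Or.inl this

lemma cantorLimit_mem_of_le (hf : IsAdmissibleBase C f) (hx : x ∈ cantorLimit C f)
    (h : x n ∈ C 0) {i : ℕ} (hi : n ≤ i) : x i ∈ C 0 := by
  induction i, hi using Nat.le_induction with
  | base => exact h
  | succ i _ ih => exact (cantorLimit_cases hx i).resolve_left fun h' =>
      (hf.2.2.1 (x (i + 1)) _ ih).ne h'.symm

lemma continuous_defect (hf : Continuous f) : Continuous (defect f) :=
  continuous_pi fun n => (continuous_subtype_val.comp (continuous_apply n)).sub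
    (continuous_subtype_val.comp (hf.comp (continuous_apply (n + 1))))

lemma defect_of_mem (hf : IsAdmissibleBase C f) (h : x (n + 1) ∈ C 0) : defect f x n = x n := by
  simp [defect, hf.map_mem h]

lemma succ_mem_of_defect_ne (hx : x ∈ cantorLimit C f) (h : defect f x n ≠ 0) :
    x (n + 1) ∈ C 0 :=
  (cantorLimit_cases hx n).resolve_left fun h' => h (by simp only [defect, ← h', sub_self])

lemma coord_mem_of_defect_ne (hf : IsAdmissibleBase C f) (hx : x ∈ cantorLimit C f)
    (h : defect f x n ≠ 0) {i : ℕ} (hi : n < i) : x i ∈ C 0 :=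
  cantorLimit_mem_of_le hf hx (succ_mem_of_defect_ne hx h) hi

lemma defect_zero (hf : IsAdmissibleBase C f) : defect f 0 = 0 := by
  ext n
  simp [defect, hf.map_zero]

lemma defect_mem_branchSet (hf : IsAdmissibleBase C f) (hx : x ∈ cantorLimit C f) :
    defect f x ∈ branchSet (Subtype.val '' C 0) := by
  intro n
  refine ⟨?_, fun hn i hi => ?_⟩
  · rcases cantorLimit_cases hx n with h | h
    · simp only [defect, ← h, sub_self, le_refl]
    · rw [defect_of_mem hf h]
      exact (x n).2.1
  · have h : ∀ {i}, n < i → x i ∈ C 0 := coord_mem_of_defect_ne hf hx hn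
    rw [defect_of_mem hf (h (hi.trans (Nat.lt_succ_self i)))]
    exact mem_image_of_mem _ (h hi)

lemma zero_mem_cantorLimit (hC : IsNestedCantorFamily C) (hf : IsAdmissibleBase C f) :
    (0 : ℕ → unitInterval) ∈ cantorLimit C f := fun n => by
  rw [mem_cantorBonding_iff hC hf]
  exact Or.inl hf.map_zero.symm

/-- Backward orbits of the base map are trivial. -/
lemma eq_zero_of_defect_eq_zero (hf : IsAdmissibleBase C f) (h : defect f x = 0) : x = 0 := by
  have hx : ∀ n, x n = f (x (n + 1)) := fun n => by
    have := congrFun h n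
    simp only [defect, Pi.zero_apply, sub_eq_zero] at this
    exact Subtype.ext this
  have hmono : Monotone x := monotone_nat_of_le_succ fun n => (hx n).trans_le (hf.map_le _)
  have hlim : Tendsto x atTop (𝓝 (⨆ n, x n)) := tendsto_atTop_iSup hmono
  have hfix : f (⨆ n, x n) = ⨆ n, x n := by
    refine tendsto_nhds_unique ((hf.1.tendsto _).comp (hlim.comp (tendsto_add_atTop_nat 1))) ?_
    exact hlim.congr hx
  have h0 : (⨆ n, x n) = 0 := by
    by_contra hne
    exact (hf.2.2.2 _ (unitInterval.pos_iff_ne_zero.2 hne)).ne hfix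
  ext n
  have : x n ≤ 0 := h0 ▸ le_iSup x n
  exact congrArg Subtype.val (le_antisymm this unitInterval.nonneg' : x n = 0)

/-- After a nonzero defect the coordinates equal the defects; the remaining ones are recovered
downwards from `x i = defect f x i + f (x (i + 1))`. -/
lemma injOn_defect (hf : IsAdmissibleBase C f) : InjOn (defect f) (cantorLimit C f) := by
  intro x hx y hy h
  by_cases h0 : defect f x = 0
  · rw [eq_zero_of_defect_eq_zero hf h0, eq_zero_of_defect_eq_zero hf (h.symm.trans h0)]
  obtain ⟨n, hn⟩ := Function.ne_iff.1 h0
  have htail : ∀ i, n < i → x i = y i := fun i hi => by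
    have h1 := defect_of_mem hf (coord_mem_of_defect_ne hf hx hn (hi.trans (Nat.lt_succ_self i)))
    have h2 := defect_of_mem hf
      (coord_mem_of_defect_ne hf hy (h ▸ hn) (hi.trans (Nat.lt_succ_self i)))
    exact Subtype.ext (h1.symm.trans (h ▸ h2))
  have hstep : ∀ i, x (i + 1) = y (i + 1) → x i = y i := fun i hi => by
    have := congrFun h i
    simp only [defect, hi, sub_left_inj] at this
    exact Subtype.ext this
  ext i
  congr 1
  rcases lt_or_ge n i with hi | hi
  · exact htail i hi
  · refine Nat.decreasingInduction' (P := fun i => x i = y i) (fun k _ _ => hstep k)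
      (hi.trans (Nat.le_succ n)) (htail _ (Nat.lt_succ_self n))

lemma shift_mem_cantorLimit (hx : x ∈ cantorLimit C f) (N : ℕ) :
    (fun i => x (N + i)) ∈ cantorLimit C f := fun n => hx (N + n)

lemma limitArc_subset (hC : IsNestedCantorFamily C) (hf : IsAdmissibleBase C f)
    (hx : x ∈ cantorLimit C f) : limitArc f x ⊆ cantorLimit C f := by
  intro y hy n
  rw [mem_cantorBonding_iff hC hf]
  rcases hy n with h | ⟨h1, h2⟩
  · exact Or.inl h
  · rw [h1]
    have hxn := (mem_cantorBonding_iff hC hf).1 (hx n)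
    rcases hxn with h | ⟨h, h'⟩
    · rw [← h, uIcc_self] at h2
      exact Or.inl (h2.trans h)
    · rw [hf.map_mem h, uIcc_of_le unitInterval.nonneg'] at h2
      exact Or.inr ⟨h, fun r hr => h' r (hr.trans_le h2.2)⟩

lemma defect_image_limitArc (hf : IsAdmissibleBase C f)
    (hx : x ∈ cantorLimit C f) : defect f '' limitArc f x = stem (defect f x) := by
  have hx0 : ∀ n, 0 ≤ defect f x n := fun n => (defect_mem_branchSet hf hx n).1
  apply subset_antisymm
  · rintro _ ⟨y, hy, rfl⟩ n
    by_cases hn : defect f y n = 0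
    · simp [hn, hx0 n]
    have hyn : y n ≠ f (y (n + 1)) := fun h => hn (by simp only [defect, ← h, sub_self])
    obtain ⟨h1, h2⟩ := (hy n).resolve_left hyn
    have hmem : x (n + 1) ∈ C 0 := (cantorLimit_cases hx n).resolve_left fun h => by
      rw [← h, uIcc_self] at h2
      exact hyn (h2.trans (h.trans (congrArg f h1.symm)))
    rw [hf.map_mem hmem, uIcc_of_le unitInterval.nonneg'] at h2
    -- Once `y` meets `x` in `C 0` it can never be on the graph of `f` again, so the whiskers force
    -- it to follow `x`.
    have htail : ∀ i, n + 1 ≤ i → y i = x i := fun i hi => by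
      induction i, hi using Nat.le_induction with
      | base => exact h1
      | succ i hi ih =>
        refine ((hy i).resolve_left fun h => ?_).1
        exact (hf.2.2.1 (y (i + 1)) _ (cantorLimit_mem_of_le hf hx hmem hi)).ne (h.symm.trans ih)
    rw [defect_of_mem hf hmem, defect_of_mem hf (h1 ▸ hmem)]
    refine ⟨(y n).2.1, h2.2, fun _ i hi => ?_⟩
    simp only [defect, htail i hi, htail (i + 1) (Nat.le_succ_of_le hi)]
  · intro w hw
    by_cases hw0 : w = 0
    · exact ⟨0, fun n => Or.inl hf.map_zero.symm, by rw [hw0, defect_zero hf]⟩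
    obtain ⟨n, h1, h2, h3⟩ := exists_eq_cutAt hw hw0
    have hne : defect f x n ≠ 0 := (h1.trans_le h2).ne'
    have hmem : ∀ i, n < i → x i ∈ C 0 := fun i hi => coord_mem_of_defect_ne hf hx hne hi
    rw [defect_of_mem hf (hmem _ (Nat.lt_succ_self n))] at h2
    let t : unitInterval := ⟨w n, h1.le, h2.trans (x n).2.2⟩
    -- The preimage of a cut: `x` after `n`, the lowered value at `n`, and forward iterates of `f`
    -- before, which have defect zero.
    let y : ℕ → unitInterval := fun i => if n < i then x i else f^[n - i] t
    have hyt : ∀ i, n < i → y i = x i := fun i hi => if_pos hi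
    have hyn : y n = t := by simp [y]
    have hys : ∀ i, i < n → y i = f (y (i + 1)) := fun i hi => by
      simp only [y, if_neg hi.not_gt, if_neg (show ¬ n < i + 1 by omega)]
      rw [← Function.iterate_succ_apply' f, show n - i = (n - (i + 1)).succ by omega]
    refine ⟨y, fun i => ?_, ?_⟩
    · rcases lt_trichotomy i n with h | rfl | h
      · exact Or.inl (hys i h)
      · refine Or.inr ⟨hyt _ (Nat.lt_succ_self i), ?_⟩
        rw [hyn, hf.map_mem (hmem _ (Nat.lt_succ_self i)), uIcc_of_le unitInterval.nonneg']
        exact ⟨unitInterval.nonneg', h2⟩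
      · refine Or.inr ⟨hyt _ (h.trans (Nat.lt_succ_self i)), ?_⟩
        rw [hyt i h]
        exact right_mem_uIcc
    · rw [h3]
      refine eq_cutAt (fun i hi => ?_) ?_ fun i hi => ?_
      · simp only [defect, hys i hi, sub_self]
      · simp only [defect, hyn, hyt _ (Nat.lt_succ_self n),
          hf.map_mem (hmem _ (Nat.lt_succ_self n))]
        simp [t]
      · simp only [defect, hyt i hi, hyt _ (hi.trans (Nat.lt_succ_self i))]

lemma exists_ne_zero_mem_cantorLimit (hC : IsNestedCantorFamily C) (hf : IsAdmissibleBase C f) :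
    ∃ x ∈ cantorLimit C f, x ≠ 0 := by
  have h01 : (0 : Icc (0 : ℚ) 1) < 1 := by
    rw [← Subtype.coe_lt_coe]
    exact zero_lt_one
  obtain ⟨c, hc⟩ := (hC.1 1).1
  -- For `c` in `C 1` the bonding set is all of `[0,1]`, so the constant sequence belongs to the
  -- limit.
  refine ⟨fun _ => c, fun n => ?_, fun h => (hC.2.1 1 c hc).ne' (congrFun h 0)⟩
  rw [mem_cantorBonding_iff hC hf]
  refine Or.inr ⟨hC.subset_zero 1 hc, fun r hr => (hC.2.2 1 r ?_).1.1 hc⟩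
  rw [← Subtype.coe_lt_coe]
  exact_mod_cast hr.trans_le c.2.2

end Limit

/-! ### Transfer from the branch set back to the limit. -/

theorem theorem3p9 (C : Icc (0 : ℚ) 1 → Set unitInterval) (hC : IsNestedCantorFamily C)
    (f : unitInterval → unitInterval) (hf : IsAdmissibleBase C f) :
    IsContinuum (cantorLimit C f) ∧
    IsTreeLike (cantorLimit C f) ∧
    IsHereditarilyDecomposable (cantorLimit C f) ∧
    (∀ x ∈ cantorLimit C f, x ≠ 0 → IsArcBetween (limitArc f x) x 0) ∧
    ∀ K : Set (ℕ → unitInterval), K ⊆ cantorLimit C f → IsContinuum K →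
      (0 ∈ K → K = ⋃ x ∈ K, limitArc f x) ∧
      (0 ∉ K →
        (∀ᶠ n in cofinite, ((fun x : ℕ → unitInterval => x n) '' K).Subsingleton) ∧
        (K.Nontrivial → ∃ x, IsSeparatingPoint K x)) := by
  set X := cantorLimit C f with hX
  have hXc : IsCompact X := (isClosed_cantorLimit hC hf).isCompact
  have hd : Continuous (defect f) := continuous_defect hf.1
  have hi : InjOn (defect f) X := injOn_defect hf
  have h0X : 0 ∈ X := zero_mem_cantorLimit hC hf
  have hE := hC.dense_compl
  have hE0 : (0 : ℝ) ∉ (Subtype.val '' C 0 : Set ℝ) := by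
    rintro ⟨t, ht, h⟩
    exact hC.zero_notMem ((Subtype.ext h : t = 0) ▸ ht)
  have hEc : IsCompact (Subtype.val '' C 0 : Set ℝ) :=
    (hC.isClosed 0).isCompact.image continuous_subtype_val
  have hEne : (Subtype.val '' C 0 : Set ℝ).Nonempty := (hC.1 0).1.image _
  have hpos : ∀ x ∈ X, ∀ i, 0 ≤ defect f x i := fun x hx i => (defect_mem_branchSet hf hx i).1
  have hbr : ∀ S ⊆ X, defect f '' S ⊆ branchSet (Subtype.val '' C 0) := by
    rintro S hS _ ⟨x, hx, rfl⟩
    exact defect_mem_branchSet hf (hS hx)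
  have hpre : ∀ S ⊆ X, IsPreconnected (defect f '' S) → IsPreconnected S := fun S hS =>
    isPreconnected_of_image hXc hd hi hS
  have hLX : ∀ x ∈ X, limitArc f x ⊆ X := fun x hx => limitArc_subset hC hf hx
  have hdL : ∀ x ∈ X, defect f '' limitArc f x = stem (defect f x) := fun x hx =>
    defect_image_limitArc hf hx
  have hselfL : ∀ x, x ∈ limitArc f x := fun x n => Or.inr ⟨rfl, right_mem_uIcc⟩
  have h0L : ∀ x, 0 ∈ limitArc f x := fun x n => Or.inl hf.map_zero.symm
  have hstem : ∀ z ∈ defect f '' X, stem z ⊆ defect f '' X := by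
    rintro _ ⟨x, hx, rfl⟩
    rw [← hdL x hx]
    exact image_mono (hLX x hx)
  have hLpre : ∀ x ∈ X, IsPreconnected (limitArc f x) := fun x hx => hpre _ (hLX x hx) <| by
    rw [hdL x hx]
    exact isPreconnected_stem (hpos x hx)
  have hinvX : ∀ {S T}, S ⊆ X → T ⊆ X → defect f '' S ⊆ defect f '' T → S ⊆ T :=
    fun {S T} hS hT h => (hi.image_subset_image_iff hS hT).1 h
  have himgK : ∀ K, IsContinuum K → IsContinuum (defect f '' K) := fun K hK =>
    ⟨hK.1.image hd, hK.2.image _ hd.continuousOn⟩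
  have h0K : ∀ K ⊆ X, 0 ∉ K → (0 : ℕ → ℝ) ∉ defect f '' K := by
    rintro K hKX h ⟨x, hx, hx0⟩
    exact h (eq_zero_of_defect_eq_zero hf hx0 ▸ hx)
  refine ⟨⟨hXc, ⟨0, h0X⟩, isPreconnected_of_forall 0 fun x hx =>
    ⟨limitArc f x, hLX x hx, h0L x, hselfL x, hLpre x hx⟩⟩, ?_, ?_, ?_, ?_⟩
  · obtain ⟨o, ho, ho0⟩ := exists_ne_zero_mem_cantorLimit hC hf
    have hdo : defect f o ≠ 0 := fun h => ho0 (eq_zero_of_defect_eq_zero hf h)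
    -- The sequence of quotients starts at `N` so that each image contains a point other than `0`.
    obtain ⟨N, hN⟩ := eventually_atTop.1 (eventually_squash_ne hEc.isClosed hEne hE hdo)
    refine isTreeLike_of_quotients (q := fun n => squash (Subtype.val '' C 0) (N + n) ∘ defect f)
      hXc (fun n => continuous_squash.comp hd) ?_ (fun n x y h => squash_eq_of_succ h) fun n => ?_
    · refine fun x hx y hy h => hi hx hy (by_contra fun hne => ?_)
      obtain ⟨M, hM⟩ := eventually_atTop.1 (eventually_squash_ne hEc.isClosed hEne hE hne)
      exact hM (N + M) (Nat.le_add_left _ _) (h M)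
    · rw [image_comp]
      refine isTopologicalTree_squash_image hEc (hXc.image hd) (hbr X subset_rfl) hstem
        (mem_image_of_mem _ ho) ?_
      have := hN (N + n) (Nat.le_add_right _ _)
      rwa [squash_zero] at this
  · intro K hKX hK hKn
    obtain ⟨A, B, hA, hB, hAK, hBK, hAB⟩ := isDecomposable_of_subset_branchSet hE hE0 (hbr K hKX)
      (himgK K hK) (hKn.image_of_injOn (hi.mono hKX))
    have himg : ∀ S ⊆ defect f '' K, defect f '' (K ∩ defect f ⁻¹' S) = S := fun S hS => by
      rw [image_inter_preimage, inter_eq_right]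
      exact hS
    have hcont : ∀ S ⊆ defect f '' K, IsContinuum S → IsContinuum (K ∩ defect f ⁻¹' S) :=
      fun S hS hSc => by
        refine ⟨hK.1.inter_right (hSc.1.isClosed.preimage hd), ?_,
          hpre _ (inter_subset_left.trans hKX) ?_⟩
        · rw [← image_nonempty (f := defect f), himg S hS]
          exact hSc.2.nonempty
        · rw [himg S hS]
          exact hSc.2.isPreconnected
    have hproper : ∀ S ⊂ defect f '' K, K ∩ defect f ⁻¹' S ⊂ K := fun S hS => by
      refine ssubset_of_subset_of_ne inter_subset_left fun h => hS.ne ?_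
      rw [← himg S hS.1, h]
    refine ⟨_, _, hcont A hAK.1 hA, hcont B hBK.1 hB, hproper A hAK, hproper B hBK, ?_⟩
    rw [← inter_union_distrib_left, ← preimage_union, hAB, inter_eq_left]
    exact subset_preimage_image _ _
  · intro x hx hx0
    have hLc : IsCompact (limitArc f x) := by
      have : limitArc f x = X ∩ defect f ⁻¹' stem (defect f x) := by
        refine subset_antisymm (fun y hy => ⟨hLX x hx hy, hdL x hx ▸ mem_image_of_mem _ hy⟩) ?_
        refine hinvX inter_subset_left (hLX x hx) ?_
        rw [hdL x hx, image_inter_preimage]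
        exact inter_subset_right
      rw [this]
      exact hXc.inter_right ((isCompact_stem _).isClosed.preimage hd)
    have hmaps : MapsTo (defect f) (limitArc f x) (stem (defect f x)) := fun y hy =>
      hdL x hx ▸ mem_image_of_mem _ hy
    refine (isArcBetween_of_injOn (σ := height ∘ defect f) hLc (hLpre x hx)
      (continuous_height.comp hd).continuousOn
      ((injOn_height_stem _).comp (hi.mono (hLX x hx)) hmaps) (h0L x) (hselfL x) hx0.symm
      fun z hz => ⟨?_, ?_⟩).symm
    · refine strictMono_height.monotone fun n => ?_
      rw [defect_zero hf]
      exact (hmaps hz n).1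
    · exact strictMono_height.monotone fun n => (hmaps hz n).2.1
  · intro K hKX hK
    have hK' := himgK K hK
    refine ⟨fun h0 => ?_, fun h0 => ⟨?_, fun hKn => ?_⟩⟩
    · refine subset_antisymm (fun x hx => mem_iUnion₂.2 ⟨x, hx, hselfL x⟩)
        (iUnion₂_subset fun x hx => hinvX (hLX x (hKX hx)) hKX ?_)
      rw [hdL x (hKX hx)]
      exact stem_subset hE (hbr K hKX) hK'.1 hK'.2.isPreconnected ⟨0, h0, defect_zero hf⟩
        (mem_image_of_mem _ hx)
    · obtain ⟨N, hN⟩ := exists_subsingleton_coord hE hE0 (hbr K hKX) hK'.1 hK'.2.isPreconnected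
        (h0K K hKX h0)
      rw [Nat.cofinite_eq_atTop]
      filter_upwards [eventually_gt_atTop N] with n hn
      rintro _ ⟨x, hx, rfl⟩ _ ⟨y, hy, rfl⟩
      -- Constancy of the defects from `n` on gives constancy of the coordinate `n` itself, by
      -- injectivity of `defect` on the shifted sequences.
      have h := hi (shift_mem_cantorLimit (hKX hx) n) (shift_mem_cantorLimit (hKX hy) n)
        (funext fun i => hN (n + i) (by omega) ⟨_, mem_image_of_mem _ hx, rfl⟩
          ⟨_, mem_image_of_mem _ hy, rfl⟩)
      exact congrFun h 0
    · obtain ⟨n, t, _, ⟨a, ha, rfl⟩, _, ⟨b, hb, rfl⟩, _, ⟨y, hy, rfl⟩, hat, htb, hyt, huniq⟩ :=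
        exists_level hE hE0 (hbr K hKX) hK'.1 hK'.2.isPreconnected (h0K K hKX h0)
          (hKn.image_of_injOn (hi.mono hKX))
      exact ⟨y, isSeparatingPoint_of_level ((continuous_apply n).comp hd) hy
        (fun z hz hzt => hi (hKX hz) (hKX hy) (huniq _ (mem_image_of_mem _ hz) hzt)) hyt ha hb
        hat htb⟩
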